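/- Let $G$ be a finite abelian group with dual $\widehat G$. For $K\subseteq\widehat G$ and $\rho\in(0,1]$ let $B(K,\rho)=\{x\in G:|\gamma(x)-1|\le\rho\text{ for all }\gamma\in K\}$ be the Bohr set of rank $|K|$ and width $\rho$; $B=B(K,\rho)$ is *regular* if for all $\epsilon\in(0,1/(100|K|))$ (all $\epsilon>0$ if $K=\emptyset$) $|B(K,\rho(1+\epsilon))|\le|B|(1+100|K|\epsilon)$ and $|B(K,\rho(1-\epsilon))|\ge|B|(1-100|K|\epsilon)$. The *VC-dimension* of $A\subseteq G$ is the maximum size of a set shattered by the family of translates $\{g+A:g\in G\}$. $A$ is *$k$-stable* if there are no $a_1,\dots,a_k,b_1,\dots,b_k\in G$ such that $a_i+b_j\in A\iff i\le j$ for all $1\le i,j\le k$. Logarithms are natural. **(1) Sets of bounded VC-dimension are dense on Bohr sets.** There are absolute constants $C,c>0$ such that the following holds for every finite abelian group $G$. Let $\eta,\beta,\rho,\sigma\in(0,1]$ and $d\in\mathbb N=\{0,1,2,\dots\}$. Suppose that $A\subseteq G$ has VC-dimension at most $d$, and that $B=B(K,\rho)$ is a Bohr set of density $|B|/|G|=\beta$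 with $|A\cap B|\ge\sigma|B|$. Then there are $x\in G$, a regular Bohr set $B'=B(K',\rho')\subseteq B$ with $\rho'\in(0,1]$, and an integer $t'\ge 0$ such that $$|K'|\le|K|+t',\qquad \rho'\ge \frac{c\,\rho\,\eta}{\max(|K|,1)^2\max(t',1)},\qquad t'\le C\Big(\log\tfrac1\sigma+\eta^{-2}d\,\log^2\tfrac2\eta\,\log\tfrac1{\sigma\beta}\Big),$$ and $|A\cap(B'+x)|\ge(1-\eta)|B'|$. **(2) Stable sets are dense on Bohr sets.** There are absolute constants $C_1\ge1$ and $C_2>0$ such that the following holds for every finite abelian group $G$. Let $\epsilon\in(0,1/6)$, $\rho\in(0,1]$ and $k\in\mathbb N$. Suppose that $A\subseteq G$ is $k$-stable and that $B=B(K,\rho)$ is a Bohr set with $|A\cap B|\ge\epsilon|B|$. Then there are $x\in G$ and a regular Bohr set $B'=B(K',\rho')\subseteq B$ with $\rho'\in(0,1]$, $$|K'|\le M,\qquad \rho'\ge C_2\,\rho\,\epsilon\,M^{-3},\qquad M:=C_1\Big(\big(|K|(1+\log\rho^{-1})+1\big)\,k\,\epsilon^{-3}+\log\epsilon^{-1}\Big),$$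 such that $|A\cap(B'+x)|\ge(1-\epsilon)|B'|$. -/

import Mathlib

namespace StableBohr

open Classical in
/-- The Bohr set `B(K, ρ) = {x ∈ G : |γ(x) - 1| ≤ ρ for all γ ∈ K}` in a finite abelian group.
Characters of a finite group take values on the unit circle, so `AddChar G ℂ` is the dual group. -/
noncomputable def bohrSet {G : Type*} [AddCommGroup G] [Fintype G]
    (K : Finset (AddChar G ℂ)) (ρ : ℝ) : Finset G :=
  Finset.univ.filter (fun x => ∀ γ ∈ K, ‖γ x - 1‖ ≤ ρ)

/-- Regularity of the Bohr set `B(K, ρ)`: for all `ε ∈ (0, 1/(100|K|))` (all `ε > 0` if `K = ∅`),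
`|B(K, ρ(1+ε))| ≤ |B|(1 + 100|K|ε)` and `|B(K, ρ(1-ε))| ≥ |B|(1 - 100|K|ε)`. -/
def IsRegularBohr {G : Type*} [AddCommGroup G] [Fintype G]
    (K : Finset (AddChar G ℂ)) (ρ : ℝ) : Prop :=
  ∀ ε : ℝ, 0 < ε → 100 * (K.card : ℝ) * ε < 1 →
    ((bohrSet K (ρ * (1 + ε))).card : ℝ)
        ≤ ((bohrSet K ρ).card : ℝ) * (1 + 100 * (K.card : ℝ) * ε) ∧
    ((bohrSet K ρ).card : ℝ) * (1 - 100 * (K.card : ℝ) * ε)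
        ≤ ((bohrSet K (ρ * (1 - ε))).card : ℝ)

/-- The translate `S + x`. -/
def translate {G : Type*} [AddCommGroup G] [DecidableEq G] (S : Finset G) (x : G) : Finset G :=
  S.image (fun b => b + x)

/-- The VC-dimension of `A ⊆ G`: the VC-dimension of the family of translates
`{g + A : g ∈ G}`, that is, the largest size of a set shattered by this family. -/
def vcDimension {G : Type*} [AddCommGroup G] [Fintype G] [DecidableEq G] (A : Finset G) : ℕ :=
  (Finset.univ.image (fun g : G => translate A g)).vcDim

/-- The `k`-order property. -/
def HasOrderProperty {G : Type*} [AddCommGroup G] (k : ℕ) (A : Finset G) : Prop :=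
  ∃ a b : Fin k → G, ∀ i j : Fin k, a i + b j ∈ A ↔ i ≤ j

/-- `A` is `k`-stable if it does not have the `k`-order property. -/
def IsStable {G : Type*} [AddCommGroup G] (k : ℕ) (A : Finset G) : Prop :=
  ¬ HasOrderProperty k A

end StableBohr

/-!
The first part reduces to a statement about the density `α = |A| / |G| ≥ σβ` of `A` in the whole
group; the given Bohr set only contributes its frequencies and its width. Let `r(y) = |A ∩ (A + y)|`
be the autocorrelation of `A` (`autocorr`). If `r(y) ≥ (1 - η)|A|` for all `y` in a Bohr set `B'`,
double counting gives a translate of `B'` of which `A` contains a proportion `1 - η`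
(`exists_le_card_inter_translate_of_autocorr`), so the task is to find such a `B'`.

Bounded VC-dimension enters through a packing lemma (`log_card_le_of_separated`): translates of `A`
that pairwise differ in at least `δ|G|` points number at most `(4/δ)^{3d}`. Hence the set `T` of
shifts `t` with `r(t) ≥ (1 - η/8)|A|` satisfies `log (|G|/|T|) ≪ d log (32/(ηα))`
(`exists_almost_invariant_shifts`).

Because `|G|(|A| - r(y)) = ∑_γ |Â(γ)|² (1 - Re γ(y))` has nonnegative weights, smallness at the points
of `T` forces most of the weight onto the large spectrum of `T`, and so `|A| - r(y)` is small wherever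
the characters in that spectrum are close to `1` (`card_sub_autocorr_le`). By Chang's theorem
(`exists_largeSpectrum_subset_addSpan`) that spectrum lies in the span of `t' ≪ log (|G|/|T|)`
characters, so it suffices to add these to the frequencies and to take the width at most a constant
times `η / t'`. A regular width is available at every scale (`exists_isRegularBohr`). If `A` has
density at least `1 - η` in `G`, no new characters are needed, by averaging; otherwise
`log (1/α) ≥ η`, so that `d log (32/(ηα))` is within the claimed bound (`rank_bound_aux`).

The second part is the first with `σ = η = ε` and `d = k`: a shattered set of size `k` gives the
`k`-order property (`IsStable.vcDimension_le`), the density of a Bohr set is bounded below in terms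
of its rank and width (`log_card_div_card_bohrSet_le`), and `log³ (2/ε) ≪ 1/ε`.
-/

namespace StableBohr

/-! ### Set families of small VC-dimension -/

/-- A weighted form of the bound `∑_{i ≤ d} (m choose i) ≤ x⁻ᵈ (1 + x)ᵐ`, valid for `0 < x ≤ 1`. -/
lemma card_filter_card_le_mul_pow {α : Type*} (U : Finset α) (d : ℕ) {x : ℝ} (hx0 : 0 < x)
    (hx1 : x ≤ 1) :
    ((U.powerset.filter (fun W => W.card ≤ d)).card : ℝ) * x ^ d ≤ (1 + x) ^ U.card := by
  have h1 : (1 + x) ^ U.card = ∑ W ∈ U.powerset, x ^ W.card := by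
    have := Finset.sum_pow_mul_eq_add_pow x 1 U
    simp only [one_pow, mul_one] at this
    rw [this, add_comm]
  rw [h1, ← nsmul_eq_mul, ← Finset.sum_const]
  calc ∑ W ∈ U.powerset.filter (fun W => W.card ≤ d), x ^ d
      ≤ ∑ W ∈ U.powerset.filter (fun W => W.card ≤ d), x ^ W.card :=
        Finset.sum_le_sum fun W hW =>
          pow_le_pow_of_le_one hx0.le hx1 (Finset.mem_filter.1 hW).2
    _ ≤ _ := Finset.sum_le_sum_of_subset_of_nonneg (Finset.filter_subset _ _)
        fun _ _ _ => by positivity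

/-- Sauer–Shelah for the traces of a family on a set `U` that tells its members apart. -/
lemma card_mul_pow_le_of_injOn_inter {α : Type*} [DecidableEq α] (𝒜 : Finset (Finset α))
    (U : Finset α) (hU : Set.InjOn (fun S => S ∩ U) (𝒜 : Set (Finset α))) {x : ℝ} (hx0 : 0 < x)
    (hx1 : x ≤ 1) :
    (𝒜.card : ℝ) * x ^ 𝒜.vcDim ≤ (1 + x) ^ U.card := by
  refine le_trans ?_ (card_filter_card_le_mul_pow U 𝒜.vcDim hx0 hx1)
  refine mul_le_mul_of_nonneg_right (Nat.cast_le.2 ?_) (by positivity)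
  rw [← Finset.card_image_of_injOn hU]
  refine (Finset.card_le_card_shatterer _).trans (Finset.card_le_card fun W hW => ?_)
  rw [Finset.mem_shatterer] at hW
  have hWU : W ⊆ U := by
    obtain ⟨t, ht, hWt⟩ := hW.exists_superset
    obtain ⟨S, -, rfl⟩ := Finset.mem_image.1 ht
    exact hWt.trans Finset.inter_subset_right
  refine Finset.mem_filter.2 ⟨Finset.mem_powerset.2 hWU, Finset.Shatters.card_le_vcDim ?_⟩
  intro t ht
  obtain ⟨u, hu, rfl⟩ := hW ht
  obtain ⟨S, hS, rfl⟩ := Finset.mem_image.1 hu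
  refine ⟨S, hS, ?_⟩
  ext a
  simp only [Finset.mem_inter]
  exact ⟨fun h => ⟨h.1, h.2, hWU h.1⟩, fun h => ⟨h.1, h.2.1⟩⟩

open scoped symmDiff in
/-- If any two members of a family differ on a proportion `δ` of the ground set, then some set of
at most `2 log |𝒜| / δ + 1` points tells all the members apart: a random sample does. -/
lemma exists_injOn_inter {α : Type*} [Fintype α] [DecidableEq α] (𝒜 : Finset (Finset α))
    {δ : ℝ} (hδ0 : 0 < δ) (hδ1 : δ ≤ 1) (h𝒜 : 𝒜.Nonempty)
    (hsep : ∀ S ∈ 𝒜, ∀ R ∈ 𝒜, S ≠ R → δ * Fintype.card α ≤ ((S ∆ R).card : ℝ)) :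
    ∃ U : Finset α, Set.InjOn (fun S => S ∩ U) (𝒜 : Set (Finset α)) ∧
      (U.card : ℝ) ≤ 2 * Real.log 𝒜.card / δ + 1 := by
  rcases isEmpty_or_nonempty α with hα | hα
  · refine ⟨∅, fun S _ R _ _ => Subsingleton.elim S R, ?_⟩
    have : 0 ≤ Real.log 𝒜.card := Real.log_natCast_nonneg _
    simp only [Finset.card_empty, Nat.cast_zero]
    positivity
  set N : ℝ := (𝒜.card : ℝ) with hN
  have hN1 : 1 ≤ N := by
    rw [hN]; exact_mod_cast h𝒜.card_pos
  have hlog : 0 ≤ Real.log N := Real.log_nonneg hN1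
  set m : ℕ := ⌈2 * Real.log N / δ⌉₊ with hm
  set n : ℝ := (Fintype.card α : ℝ) with hn
  have hn0 : 0 < n := by rw [hn]; exact_mod_cast Fintype.card_pos
  have hmge : 2 * Real.log N / δ ≤ m := Nat.le_ceil _
  have hmle : (m : ℝ) ≤ 2 * Real.log N / δ + 1 := (Nat.ceil_lt_add_one (by positivity)).le
  -- the samples that fail to tell apart a given pair
  let bad : Finset α × Finset α → Finset (Fin m → α) :=
    fun p => Fintype.piFinset fun _ => (p.1 ∆ p.2)ᶜ
  have hbad : ∀ p ∈ 𝒜.offDiag, ((bad p).card : ℝ) ≤ (1 - δ) ^ m * n ^ m := by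
    intro p hp
    obtain ⟨h1, h2, h3⟩ := Finset.mem_offDiag.1 hp
    have := hsep _ h1 _ h2 h3
    have hc : (((p.1 ∆ p.2)ᶜ.card : ℕ) : ℝ) ≤ (1 - δ) * n := by
      rw [Finset.card_compl, Nat.cast_sub (Finset.card_le_univ _)]
      linarith
    simp only [bad, Fintype.card_piFinset_const, Nat.cast_pow]
    rw [← mul_pow]
    exact pow_le_pow_left₀ (Nat.cast_nonneg _) hc m
  have hexp : N * N * (1 - δ) ^ m ≤ 1 := by
    have h1 : (1 - δ) ^ m ≤ Real.exp (-(δ * m)) := by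
      have := pow_le_pow_left₀ (by linarith) (Real.one_sub_le_exp_neg δ) m
      rwa [← Real.exp_nat_mul, show (m : ℝ) * -δ = -(δ * m) by ring] at this
    have h2 : Real.exp (-(δ * m)) ≤ Real.exp (-(2 * Real.log N)) := by
      apply Real.exp_le_exp.2
      rw [div_le_iff₀ hδ0] at hmge
      linarith
    have h3 : N * N = Real.exp (2 * Real.log N) := by
      rw [two_mul, Real.exp_add, Real.exp_log (by linarith)]
    calc N * N * (1 - δ) ^ m ≤ N * N * Real.exp (-(2 * Real.log N)) := by
          gcongr; exact h1.trans h2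
      _ = 1 := by rw [h3, ← Real.exp_add]; simp
  have hcount : ((𝒜.offDiag.biUnion bad).card : ℝ)
      < ((Finset.univ : Finset (Fin m → α)).card : ℝ) := by
    have h1 : ((𝒜.offDiag.biUnion bad).card : ℝ) ≤ ∑ p ∈ 𝒜.offDiag, ((bad p).card : ℝ) := by
      exact_mod_cast Finset.card_biUnion_le
    have h2 : ∑ p ∈ 𝒜.offDiag, ((bad p).card : ℝ) ≤ (N * N - N) * ((1 - δ) ^ m * n ^ m) := by
      refine (Finset.sum_le_sum hbad).trans_eq ?_
      rw [Finset.sum_const, Finset.offDiag_card, nsmul_eq_mul,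
        Nat.cast_sub (Nat.le_mul_self _), Nat.cast_mul]
    have h3 : ((Finset.univ : Finset (Fin m → α)).card : ℝ) = n ^ m := by
      simp [hn]
    rw [h3]
    have h4 : 0 < n ^ m := by positivity
    have h5 : 0 ≤ (1 - δ) ^ m := pow_nonneg (by linarith) m
    rcases h5.eq_or_lt with h6 | h6
    · rw [← h6] at h2; simp at h2; linarith
    · have h7 : (N * N - N) * (1 - δ) ^ m < 1 := by nlinarith
      nlinarith
  obtain ⟨v, -, hv⟩ : ∃ v ∈ (Finset.univ : Finset (Fin m → α)), v ∉ 𝒜.offDiag.biUnion bad := by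
    by_contra! hcon
    exact absurd (Finset.card_le_card (fun v hv => hcon v hv)) (not_le.2 (by exact_mod_cast hcount))
  refine ⟨Finset.univ.image v, ?_, ?_⟩
  · intro S hS R hR hSR
    by_contra hne
    refine hv (Finset.mem_biUnion.2 ⟨(S, R), Finset.mem_offDiag.2 ⟨hS, hR, hne⟩, ?_⟩)
    refine Fintype.mem_piFinset.2 fun i => ?_
    have := Finset.ext_iff.1 hSR (v i)
    simp only [Finset.mem_inter, Finset.mem_image, Finset.mem_univ, true_and, exists_apply_eq_apply,
      and_true] at this
    simp [this]
  · refine le_trans ?_ hmle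
    exact_mod_cast Finset.card_image_le.trans (by simp)

open scoped symmDiff in
/-- **Packing lemma**: a `δ`-separated family of VC-dimension at most `d` has at most `(4/δ)^{3d}`
members. A sample of about `2 log |𝒜| / δ` points tells the members apart, and Sauer–Shelah on that
sample, weighted by `x = δ / 4`, bounds `log |𝒜|` by `d log (4/δ) + ½ log |𝒜| + δ/4`. -/
lemma log_card_le_of_separated {α : Type*} [Fintype α] [DecidableEq α] (𝒜 : Finset (Finset α))
    {δ : ℝ} {d : ℕ} (hδ0 : 0 < δ) (hδ1 : δ ≤ 1) (hd : 𝒜.vcDim ≤ d)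
    (hsep : ∀ S ∈ 𝒜, ∀ R ∈ 𝒜, S ≠ R → δ * Fintype.card α ≤ ((S ∆ R).card : ℝ)) :
    Real.log 𝒜.card ≤ 3 * d * Real.log (4 / δ) := by
  have hl4 : 1 ≤ Real.log (4 / δ) := by
    rw [Real.le_log_iff_exp_le (by positivity)]
    have : (4 : ℝ) ≤ 4 / δ := by rw [le_div_iff₀ hδ0]; linarith
    linarith [Real.exp_one_lt_three]
  rcases Nat.lt_or_ge 𝒜.card 2 with h2 | h2
  · have : Real.log 𝒜.card = 0 := by
      have : 𝒜.card = 0 ∨ 𝒜.card = 1 := by omega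
      rcases this with h | h <;> simp [h]
    rw [this]; positivity
  have hne : 𝒜.Nonempty := Finset.card_pos.1 (by omega)
  obtain ⟨U, hU, hUc⟩ := exists_injOn_inter 𝒜 hδ0 hδ1 hne hsep
  have hx0 : 0 < δ / 4 := by positivity
  have hx1 : δ / 4 ≤ 1 := by linarith
  have key := card_mul_pow_le_of_injOn_inter 𝒜 U hU hx0 hx1
  have hN2 : (2 : ℝ) ≤ 𝒜.card := by exact_mod_cast h2
  have hlogN : Real.log 2 ≤ Real.log 𝒜.card := Real.log_le_log (by norm_num) hN2
  have hmain : Real.log 𝒜.card ≤ d * Real.log (4 / δ) + Real.log 𝒜.card / 2 + δ / 4 := by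
    have h1 : Real.log (𝒜.card * (δ / 4) ^ 𝒜.vcDim) ≤ Real.log ((1 + δ / 4) ^ U.card) :=
      Real.log_le_log (by positivity) key
    rw [Real.log_mul (by positivity) (by positivity), Real.log_pow, Real.log_pow,
      show δ / 4 = (4 / δ)⁻¹ by rw [inv_div], Real.log_inv, inv_div] at h1
    have h3 : Real.log (1 + δ / 4) ≤ δ / 4 := by
      have := Real.log_le_sub_one_of_pos (show 0 < 1 + δ / 4 by positivity)
      linarith
    have h4 : (U.card : ℝ) * Real.log (1 + δ / 4) ≤ (2 * Real.log 𝒜.card / δ + 1) * (δ / 4) := by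
      apply mul_le_mul hUc h3 (Real.log_nonneg (by linarith))
      exact (Nat.cast_nonneg _).trans hUc
    have h5 : (2 * Real.log 𝒜.card / δ + 1) * (δ / 4) = Real.log 𝒜.card / 2 + δ / 4 := by
      field_simp; ring
    have h6 : (𝒜.vcDim : ℝ) * Real.log (4 / δ) ≤ d * Real.log (4 / δ) := by
      gcongr
    linarith
  have hd1 : (1 : ℝ) ≤ d := by
    rcases Nat.eq_zero_or_pos d with h | h
    · rw [h] at hmain
      have := Real.log_two_gt_d9
      simp at hmain
      linarith
    · exact_mod_cast h
  nlinarith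

/-! ### Large spectra -/

open Classical in
/-- The characters whose average over `T` has real part at least `1/2`. -/
noncomputable def largeSpectrum {G : Type*} [AddCommGroup G] [Fintype G] (T : Finset G) :
    Finset (AddChar G ℂ) :=
  Finset.univ.filter fun γ => (T.card : ℝ) / 2 ≤ ∑ t ∈ T, (γ t).re

/-- The exponential moment of a dissociated sum of characters, by comparison with a Riesz
product: `exp (s u) ≤ cosh s + u sinh s` for `|u| ≤ 1`, and dissociativity makes the mean of the
product of the right-hand sides equal to `cosh s ^ |Λ|`. -/
lemma sum_exp_sum_re_le {G : Type*} [AddCommGroup G] [Fintype G] (Λ : Finset (AddChar G ℂ))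
    (hΛ : AddDissociated (Λ : Set (AddChar G ℂ))) (s : ℝ) :
    ∑ x : G, Real.exp (s * ∑ γ ∈ Λ, (γ x).re)
      ≤ Fintype.card G * Real.exp (Λ.card * (s ^ 2 / 2)) := by
  classical
  have hexp : ∀ u : ℝ, |u| ≤ 1 → Real.exp (s * u) ≤ Real.cosh s + Real.sinh s * u := by
    intro u hu
    obtain ⟨h1, h2⟩ := abs_le.1 hu
    have := convexOn_exp.2 (Set.mem_univ s) (Set.mem_univ (-s))
      (show 0 ≤ (1 + u) / 2 by linarith) (show 0 ≤ (1 - u) / 2 by linarith) (by ring)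
    simp only [smul_eq_mul] at this
    rw [Real.cosh_eq, Real.sinh_eq]
    calc Real.exp (s * u) = Real.exp ((1 + u) / 2 * s + (1 - u) / 2 * -s) := by ring_nf
      _ ≤ _ := this
      _ = _ := by ring
  let c : AddChar G ℂ → ℝ := fun γ => if γ ∈ Λ then Real.cosh s else 1
  let e : AddChar G ℂ → ℂ := fun γ => if γ ∈ Λ then (Real.sinh s : ℂ) else 0
  have hriesz := AddDissociated.randomisation c e (hΛ.subset fun γ hγ => by
    by_contra h
    exact hγ (if_neg h))
  have hprod : ∀ x : G, ∏ γ, (c γ + (e γ * γ x).re)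
      = ∏ γ ∈ Λ, (Real.cosh s + Real.sinh s * (γ x).re) := by
    intro x
    rw [← Finset.prod_subset (Finset.subset_univ Λ) (fun γ _ hγ => by simp [c, e, hγ])]
    refine Finset.prod_congr rfl fun γ hγ => ?_
    simp only [c, e, if_pos hγ, Complex.re_ofReal_mul]
  have hc : ∏ γ, c γ = Real.cosh s ^ Λ.card := by
    rw [← Finset.prod_subset (Finset.subset_univ Λ) (fun γ _ hγ => by simp [c, hγ]),
      ← Finset.prod_const]
    exact Finset.prod_congr rfl fun γ hγ => by simp only [c, if_pos hγ]
  rw [hc, Fintype.expect_eq_sum_div_card, div_eq_iff (by simp)] at hriesz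
  calc ∑ x : G, Real.exp (s * ∑ γ ∈ Λ, (γ x).re)
      ≤ ∑ x : G, ∏ γ ∈ Λ, (Real.cosh s + Real.sinh s * (γ x).re) := by
        refine Finset.sum_le_sum fun x _ => ?_
        rw [Finset.mul_sum, Real.exp_sum]
        refine Finset.prod_le_prod (fun _ _ => (Real.exp_pos _).le) fun γ _ => hexp _ ?_
        exact (Complex.abs_re_le_norm _).trans (AddChar.norm_apply γ x).le
    _ = Real.cosh s ^ Λ.card * Fintype.card G := by
        rw [← hriesz]; exact Finset.sum_congr rfl fun x _ => (hprod x).symm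
    _ ≤ Fintype.card G * Real.exp (Λ.card * (s ^ 2 / 2)) := by
        rw [mul_comm, Real.exp_nat_mul]
        gcongr
        exact Real.cosh_le_exp_half_sq s

/-- Chang's bound for dissociated subsets of the large spectrum. -/
lemma card_le_of_dissociated_largeSpectrum {G : Type*} [AddCommGroup G] [Fintype G]
    (T : Finset G) (hT : T.Nonempty) (Λ : Finset (AddChar G ℂ)) (hΛT : Λ ⊆ largeSpectrum T)
    (hΛ : AddDissociated (Λ : Set (AddChar G ℂ))) :
    (Λ.card : ℝ) ≤ 8 * Real.log (Fintype.card G / T.card) := by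
  have hT0 : (0 : ℝ) < T.card := by exact_mod_cast hT.card_pos
  have hG0 : (0 : ℝ) < Fintype.card G := by exact_mod_cast Fintype.card_pos_iff.2 ⟨hT.choose⟩
  -- Jensen's inequality over `T`, with exponent `s = 1/2`
  have hj : Real.exp (∑ t ∈ T, (1 / (T.card : ℝ)) * (1 / 2 * ∑ γ ∈ Λ, (γ t).re))
      ≤ ∑ t ∈ T, (1 / (T.card : ℝ)) * Real.exp (1 / 2 * ∑ γ ∈ Λ, (γ t).re) := by
    have := convexOn_exp.map_sum_le (t := T) (w := fun _ => 1 / (T.card : ℝ))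
      (p := fun t => 1 / 2 * ∑ γ ∈ Λ, (γ t).re) (fun _ _ => by positivity)
      (by simp [hT0.ne']) (fun _ _ => Set.mem_univ _)
    simpa only [smul_eq_mul] using this
  have hlow : (Λ.card : ℝ) / 4 ≤ ∑ t ∈ T, (1 / (T.card : ℝ)) * (1 / 2 * ∑ γ ∈ Λ, (γ t).re) := by
    rw [← Finset.mul_sum, ← Finset.mul_sum, Finset.sum_comm]
    have : (Λ.card : ℝ) * (T.card / 2) ≤ ∑ γ ∈ Λ, ∑ t ∈ T, (γ t).re := by
      rw [← nsmul_eq_mul]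
      exact Finset.card_nsmul_le_sum _ _ _ fun γ hγ => (Finset.mem_filter.1 (hΛT hγ)).2
    calc (Λ.card : ℝ) / 4 = 1 / (T.card : ℝ) * (1 / 2 * ((Λ.card : ℝ) * (T.card / 2))) := by
          field_simp; norm_num
      _ ≤ _ := by gcongr
  have hup : ∑ t ∈ T, (1 / (T.card : ℝ)) * Real.exp (1 / 2 * ∑ γ ∈ Λ, (γ t).re)
      ≤ Fintype.card G / T.card * Real.exp (Λ.card / 8) := by
    rw [← Finset.mul_sum]
    have h1 : ∑ t ∈ T, Real.exp (1 / 2 * ∑ γ ∈ Λ, (γ t).re)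
        ≤ ∑ t : G, Real.exp (1 / 2 * ∑ γ ∈ Λ, (γ t).re) :=
      Finset.sum_le_sum_of_subset_of_nonneg (Finset.subset_univ _) fun _ _ _ => (Real.exp_pos _).le
    have h2 := sum_exp_sum_re_le Λ hΛ (1 / 2)
    calc _ ≤ 1 / (T.card : ℝ) * (Fintype.card G * Real.exp (Λ.card * ((1 / 2) ^ 2 / 2))) := by
          gcongr; exact h1.trans h2
      _ = _ := by
          rw [show (Λ.card : ℝ) * ((1 / 2) ^ 2 / 2) = Λ.card / 8 by ring]; ring
  have h := (Real.exp_le_exp.2 hlow).trans (hj.trans hup)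
  have h' := Real.log_le_log (Real.exp_pos _) h
  rw [Real.log_exp, Real.log_mul (by positivity) (Real.exp_pos _).ne', Real.log_exp] at h'
  linarith

lemma norm_mul_sub_one_le {z w : ℂ} (hz : ‖z‖ = 1) : ‖z * w - 1‖ ≤ ‖z - 1‖ + ‖w - 1‖ := by
  calc ‖z * w - 1‖ = ‖z * (w - 1) + (z - 1)‖ := by ring_nf
    _ ≤ ‖z * (w - 1)‖ + ‖z - 1‖ := norm_add_le _ _
    _ = ‖z - 1‖ + ‖w - 1‖ := by rw [norm_mul, hz]; ring

lemma norm_sum_apply_sub_one_le {G : Type*} [AddCommGroup G] [Fintype G] {ι : Type*}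
    (s : Finset ι) (f : ι → AddChar G ℂ) (y : G) :
    ‖(∑ i ∈ s, f i) y - 1‖ ≤ ∑ i ∈ s, ‖f i y - 1‖ := by
  classical
  induction s using Finset.induction_on with
  | empty => simp
  | insert i s hi ih =>
    rw [Finset.sum_insert hi, Finset.sum_insert hi, AddChar.add_apply]
    exact (norm_mul_sub_one_le (AddChar.norm_apply _ _)).trans (by gcongr)

lemma norm_neg_apply_sub_one {G : Type*} [AddCommGroup G] [Fintype G] (γ : AddChar G ℂ) (y : G) :
    ‖(-γ) y - 1‖ = ‖γ y - 1‖ := by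
  rw [AddChar.neg_apply, AddChar.map_neg_eq_conj, ← RCLike.norm_conj (γ y - 1)]
  simp

/-- Every character in the `{-1, 0, 1}`-span of `Λ` is within `|Λ| r` of `1` on `B(Λ, r)`. -/
lemma norm_sub_one_le_of_mem_addSpan {G : Type*} [AddCommGroup G] [Fintype G]
    {Λ : Finset (AddChar G ℂ)} {γ : AddChar G ℂ} (hγ : γ ∈ Λ.addSpan) {y : G} {r : ℝ}
    (hy : ∀ χ ∈ Λ, ‖χ y - 1‖ ≤ r) : ‖γ y - 1‖ ≤ Λ.card * r := by
  obtain ⟨ε, hε, rfl⟩ := Finset.mem_addSpan.1 hγ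
  refine (norm_sum_apply_sub_one_le _ _ _).trans ?_
  rw [← nsmul_eq_mul]
  refine Finset.sum_le_card_nsmul _ _ _ fun χ hχ => ?_
  have h0 := hy χ hχ
  rcases hε χ with h | h | h <;> rw [h]
  · rw [neg_one_zsmul, norm_neg_apply_sub_one]; exact h0
  · simpa using (norm_nonneg _).trans h0
  · rwa [one_zsmul]

/-- **Chang's theorem** for the large spectrum. -/
lemma exists_largeSpectrum_subset_addSpan {G : Type*} [AddCommGroup G] [Fintype G]
    (T : Finset G) (hT : T.Nonempty) :
    ∃ Λ : Finset (AddChar G ℂ), (Λ.card : ℝ) ≤ 8 * Real.log (Fintype.card G / T.card) ∧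
      largeSpectrum T ⊆ Λ.addSpan := by
  have hlog : 0 ≤ 8 * Real.log ((Fintype.card G : ℝ) / T.card) := by
    have hT0 : (0 : ℝ) < T.card := by exact_mod_cast hT.card_pos
    have : (1 : ℝ) ≤ Fintype.card G / T.card := by
      rw [le_div_iff₀ hT0, one_mul]; exact_mod_cast Finset.card_le_univ T
    have := Real.log_nonneg this
    linarith
  obtain ⟨Λ, -, h1, h2⟩ := Finset.exists_subset_addSpan_card_le_of_forall_addDissociated
    (s := largeSpectrum T) (d := ⌊8 * Real.log ((Fintype.card G : ℝ) / T.card)⌋₊)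
    fun Λ hΛT hΛ => Nat.le_floor (card_le_of_dissociated_largeSpectrum T hT Λ hΛT hΛ)
  exact ⟨Λ, (Nat.le_floor_iff hlog).1 h1, h2⟩


/-! ### Bohr sets -/

section Bohr
variable {G : Type*} [AddCommGroup G] [Fintype G]

lemma mem_bohrSet {K : Finset (AddChar G ℂ)} {r : ℝ} {x : G} :
    x ∈ bohrSet K r ↔ ∀ γ ∈ K, ‖γ x - 1‖ ≤ r := by
  simp [bohrSet]

lemma bohrSet_subset_bohrSet {K K' : Finset (AddChar G ℂ)} {r r' : ℝ} (hK : K' ⊆ K)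
    (hr : r ≤ r') : bohrSet K r ⊆ bohrSet K' r' := fun _ hx =>
  mem_bohrSet.2 fun γ hγ => (mem_bohrSet.1 hx γ (hK hγ)).trans hr

lemma card_bohrSet_pos (K : Finset (AddChar G ℂ)) {r : ℝ} (hr : 0 ≤ r) :
    0 < (bohrSet K r).card :=
  Finset.card_pos.2 ⟨0, mem_bohrSet.2 fun γ _ => by simpa using hr⟩

lemma norm_apply_sub_sub_one (γ : AddChar G ℂ) (x y : G) : ‖γ (x - y) - 1‖ = ‖γ x - γ y‖ := by
  have h : γ x - γ y = γ y * (γ (x - y) - 1) := by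
    rw [mul_sub, ← AddChar.map_add_eq_mul]; simp
  rw [h, norm_mul, AddChar.norm_apply, one_mul]

lemma floor_div_mem_Icc {u R δ : ℝ} {M : ℕ} (hδ : 0 < δ) (hu : |u| ≤ R) (hR : R ≤ M * δ) :
    ⌊u / δ⌋ ∈ Finset.Icc (-(M : ℤ)) M := by
  obtain ⟨h1, h2⟩ := abs_le.1 hu
  rw [Finset.mem_Icc, Int.le_floor]
  constructor
  · push_cast
    rw [le_div_iff₀ hδ]
    linarith
  · have h3 : u / δ ≤ M := by rw [div_le_iff₀ hδ]; linarith
    exact_mod_cast (Int.floor_le _).trans h3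

lemma abs_sub_le_of_floor_div_eq {u v δ : ℝ} (hδ : 0 < δ) (h : ⌊u / δ⌋ = ⌊v / δ⌋) :
    |u - v| ≤ δ := by
  have := (Int.abs_sub_lt_one_of_floor_eq_floor h).le
  rwa [← sub_div, abs_div, abs_of_pos hδ, div_le_one hδ] at this

/-- Covering bound: the values of each character on the wider Bohr set lie in a square that splits
into `(2M+1)²` cells of side `r / 2`, and two points in the same cells differ by an element of the
narrower Bohr set. -/
lemma card_bohrSet_le_mul (K : Finset (AddChar G ℂ)) {r R : ℝ} {M : ℕ} (hr : 0 < r)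
    (hR : R ≤ M * (r / 2)) :
    (bohrSet K R).card ≤ ((2 * M + 1) ^ 2) ^ K.card * (bohrSet K r).card := by
  classical
  have hr2 : 0 < r / 2 := by positivity
  let Q : Finset (ℤ × ℤ) := Finset.Icc (-(M : ℤ)) M ×ˢ Finset.Icc (-(M : ℤ)) M
  let cell : G → K → ℤ × ℤ := fun x γ =>
    (⌊(γ.1 x - 1).re / (r / 2)⌋, ⌊(γ.1 x - 1).im / (r / 2)⌋)
  have hQ : (Fintype.piFinset fun _ : K => Q).card = ((2 * M + 1) ^ 2) ^ K.card := by
    rw [Fintype.card_piFinset, Finset.prod_const, Finset.card_univ, Fintype.card_coe,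
      Finset.card_product, Int.card_Icc,
      show ((M : ℤ) + 1 - -(M : ℤ)).toNat = 2 * M + 1 by omega, sq]
  rw [← hQ, mul_comm]
  refine Finset.card_le_mul_card_image_of_maps_to (f := cell) ?_ _ ?_
  · intro x hx
    refine Fintype.mem_piFinset.2 fun γ => ?_
    have h := mem_bohrSet.1 hx γ.1 γ.2
    exact Finset.mem_product.2
      ⟨floor_div_mem_Icc hr2 ((Complex.abs_re_le_norm _).trans h) hR,
        floor_div_mem_Icc hr2 ((Complex.abs_im_le_norm _).trans h) hR⟩
  · intro c _
    rcases ((bohrSet K R).filter fun x => cell x = c).eq_empty_or_nonempty with h | ⟨y, hy⟩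
    · simp [h]
    · refine Finset.card_le_card_of_injOn (fun x => x - y) (fun x hx => ?_)
        (fun _ _ _ _ h => sub_left_injective h)
      have hxy : cell x = cell y :=
        (Finset.mem_filter.1 hx).2.trans (Finset.mem_filter.1 hy).2.symm
      refine mem_bohrSet.2 fun γ hγ => ?_
      have hc := congr_fun hxy ⟨γ, hγ⟩
      simp only [cell, Prod.mk.injEq] at hc
      have h1 := abs_sub_le_of_floor_div_eq hr2 hc.1
      have h2 := abs_sub_le_of_floor_div_eq hr2 hc.2
      rw [norm_apply_sub_sub_one]
      refine (Complex.norm_le_abs_re_add_abs_im _).trans ?_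
      simp only [Complex.sub_re, Complex.sub_im, Complex.one_re, Complex.one_im,
        sub_sub_sub_cancel_right] at h1 h2 ⊢
      linarith

lemma exists_gt_bohrSet_eq (K : Finset (AddChar G ℂ)) (r : ℝ) :
    ∃ r' > r, bohrSet K r' = bohrSet K r := by
  have h : ∀ᶠ r' in nhdsWithin r (Set.Ioi r), bohrSet K r' = bohrSet K r := by
    have h1 : ∀ᶠ r' in nhdsWithin r (Set.Ioi r), ∀ x : G, ∀ γ ∈ K,
        ‖γ x - 1‖ ≤ r' → ‖γ x - 1‖ ≤ r := by
      refine Filter.eventually_all.2 fun x => (Filter.eventually_all_finset K).2 fun γ _ => ?_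
      rcases le_or_gt ‖γ x - 1‖ r with h | h
      · exact Filter.Eventually.of_forall fun _ _ => h
      · filter_upwards [mem_nhdsWithin_of_mem_nhds (Iio_mem_nhds h)] with r' hr' h'
        exact absurd h' (not_le.2 hr')
    filter_upwards [h1, self_mem_nhdsWithin] with r' h1 h2
    refine Finset.Subset.antisymm (fun x hx => ?_)
      (bohrSet_subset_bohrSet subset_rfl (le_of_lt h2))
    exact mem_bohrSet.2 fun γ hγ => h1 x γ hγ (mem_bohrSet.1 hx γ hγ)
  obtain ⟨r', h1, h2⟩ := (h.and self_mem_nhdsWithin).exists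
  exact ⟨r', h2, h1⟩

/-- The logarithm of the inverse density of a Bohr set is at most a multiple of
`|K| (1 + log (1 / ρ))`. -/
lemma log_card_div_card_bohrSet_le (K : Finset (AddChar G ℂ)) {ρ : ℝ} (hρ0 : 0 < ρ)
    (hρ1 : ρ ≤ 1) :
    Real.log (Fintype.card G / (bohrSet K ρ).card)
      ≤ 6 * (K.card * (1 + Real.log (1 / ρ))) := by
  have hG0 : (0 : ℝ) < Fintype.card G := by exact_mod_cast Fintype.card_pos_iff.2 ⟨0⟩
  have hB0 : (0 : ℝ) < (bohrSet K ρ).card := by exact_mod_cast card_bohrSet_pos K hρ0.le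
  have huniv : bohrSet K 2 = Finset.univ := by
    ext x
    simp only [mem_bohrSet, Finset.mem_univ, iff_true]
    intro γ _
    refine (norm_sub_le _ _).trans ?_
    rw [AddChar.norm_apply, norm_one]
    norm_num
  set M : ℕ := ⌈4 / ρ⌉₊ with hM
  have hM1 : 4 / ρ ≤ M := Nat.le_ceil _
  have hM2 : (M : ℝ) ≤ 4 / ρ + 1 := (Nat.ceil_lt_add_one (by positivity)).le
  have hcard := card_bohrSet_le_mul K (M := M) hρ0 (R := 2) (by
    rw [div_le_iff₀ hρ0] at hM1
    linarith)
  rw [huniv, Finset.card_univ] at hcard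
  have h1 : (Fintype.card G : ℝ) / (bohrSet K ρ).card ≤ ((2 * M + 1 : ℝ) ^ 2) ^ K.card := by
    rw [div_le_iff₀ hB0]
    exact_mod_cast hcard
  have h2 : (2 * M + 1 : ℝ) ≤ 11 / ρ := by
    have h3 : 1 ≤ 1 / ρ := by rw [le_div_iff₀ hρ0]; linarith
    have h4 : 2 * (4 / ρ + 1) + 1 = 8 * (1 / ρ) + 3 := by ring
    have h5 : 11 / ρ = 11 * (1 / ρ) := by ring
    linarith
  have hl0 : 0 ≤ Real.log (1 / ρ) := Real.log_nonneg (by rw [le_div_iff₀ hρ0]; linarith)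
  have h3 : Real.log (2 * M + 1) ≤ 3 * (1 + Real.log (1 / ρ)) := by
    have h4 := Real.log_le_log (by positivity) h2
    rw [show 11 / ρ = 11 * (1 / ρ) by ring, Real.log_mul (by norm_num) (by positivity)] at h4
    have h5 : Real.log 11 ≤ 3 := by
      have : Real.log 11 ≤ Real.log (2 ^ 4) := Real.log_le_log (by norm_num) (by norm_num)
      rw [Real.log_pow] at this
      push_cast at this
      linarith [Real.log_two_lt_d9]
    linarith
  have h4 := Real.log_le_log (by positivity) h1
  rw [Real.log_pow, Real.log_pow] at h4
  push_cast at h4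
  have h5 : (K.card : ℝ) * (2 * Real.log (2 * M + 1))
      ≤ K.card * (2 * (3 * (1 + Real.log (1 / ρ)))) := by gcongr
  linarith

end Bohr

/-! ### Points of bounded growth of a monotone function -/

section Growth
variable {φ : ℝ → ℝ} {L lo hi : ℝ}

/-- The least `L`-Lipschitz majorant `x ↦ sup_y (φ y - L |y - x|)`. -/
noncomputable def lipMajorant (φ : ℝ → ℝ) (L x : ℝ) : ℝ := ⨆ y, (φ y - L * |y - x|)

lemma bddAbove_lipMajorant (hL : 0 ≤ L) (hhi : ∀ x, φ x ≤ hi) (x : ℝ) :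
    BddAbove (Set.range fun y => φ y - L * |y - x|) :=
  ⟨hi, by
    rintro _ ⟨y, rfl⟩
    have := mul_nonneg hL (abs_nonneg (y - x))
    have := hhi y
    simp only
    linarith⟩

lemma le_lipMajorant (hL : 0 ≤ L) (hhi : ∀ x, φ x ≤ hi) (x y : ℝ) :
    φ y - L * |y - x| ≤ lipMajorant φ L x :=
  le_ciSup (bddAbove_lipMajorant hL hhi x) y

lemma self_le_lipMajorant (hL : 0 ≤ L) (hhi : ∀ x, φ x ≤ hi) (x : ℝ) :
    φ x ≤ lipMajorant φ L x := by
  simpa using le_lipMajorant hL hhi x x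

lemma lipMajorant_le (hL : 0 ≤ L) (hhi : ∀ x, φ x ≤ hi) (x : ℝ) : lipMajorant φ L x ≤ hi :=
  ciSup_le fun y => by
    have := mul_nonneg hL (abs_nonneg (y - x))
    have := hhi y
    linarith

lemma lipMajorant_le_add (hL : 0 ≤ L) (hhi : ∀ x, φ x ≤ hi) (x x' : ℝ) :
    lipMajorant φ L x ≤ lipMajorant φ L x' + L * |x - x'| :=
  ciSup_le fun y => by
    have h1 := le_lipMajorant hL hhi x' y
    have h2 := mul_le_mul_of_nonneg_left (abs_sub_le y x x') hL
    linarith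

lemma lipMajorant_mono (hL : 0 ≤ L) (hhi : ∀ x, φ x ≤ hi) (hφ : Monotone φ) :
    Monotone (lipMajorant φ L) := fun x x' hxx' =>
  ciSup_le fun y => by
    have h1 := le_lipMajorant hL hhi x' (y + (x' - x))
    rw [show y + (x' - x) - x' = y - x by ring] at h1
    have := hφ (show y ≤ y + (x' - x) by linarith)
    linarith

lemma continuous_lipMajorant (hL : 0 ≤ L) (hhi : ∀ x, φ x ≤ hi) :
    Continuous (lipMajorant φ L) := by
  refine (LipschitzWith.of_le_add_mul L.toNNReal fun x y => ?_).continuous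
  rw [Real.coe_toNNReal L hL, Real.dist_eq]
  exact lipMajorant_le_add hL hhi x y

/-- Where the majorant is strictly above a function that is constant just to the right, it grows
at full speed `L`. -/
lemma lipMajorant_add_le_of_lt (hL : 0 ≤ L) (hhi : ∀ x, φ x ≤ hi) (hφ : Monotone φ) {x x' : ℝ}
    (hxx' : x ≤ x') (hc : φ x' = φ x) (hlt : φ x < lipMajorant φ L x) :
    lipMajorant φ L x + L * (x' - x) ≤ lipMajorant φ L x' := by
  refine le_of_forall_pos_le_add fun e he => ?_
  obtain ⟨y, hy⟩ := exists_lt_of_lt_ciSup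
    (show max (φ x) (lipMajorant φ L x - e) < ⨆ y, (φ y - L * |y - x|) from
      max_lt hlt (by change _ - _ < lipMajorant φ L x; linarith))
  obtain ⟨hy1, hy2⟩ := max_lt_iff.1 hy
  have hyx : x' < y := by
    by_contra! h
    have h1 := hφ h
    have h2 := mul_nonneg hL (abs_nonneg (y - x))
    linarith
  have h := le_lipMajorant hL hhi x' y
  rw [abs_of_pos (by linarith)] at h hy2
  linarith

/-- Where the greatest `L`-Lipschitz minorant (written through the majorant of `-φ`) is strictly
below `φ`, it grows at full speed `L`. -/
lemma lipMajorant_neg_add_le_of_lt (hL : 0 ≤ L) (hlo : ∀ x, lo ≤ φ x) (hφ : Monotone φ) {x x' : ℝ}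
    (hxx' : x ≤ x') (hlt : L * (x' - x) ≤ φ x + lipMajorant (fun y => -φ y) L x) :
    lipMajorant (fun y => -φ y) L x' + L * (x' - x) ≤ lipMajorant (fun y => -φ y) L x := by
  have hhi : ∀ x, -φ x ≤ -lo := fun x => neg_le_neg (hlo x)
  rw [← le_sub_iff_add_le]
  refine ciSup_le fun y => ?_
  rcases le_or_gt y x with h | h
  · have h1 := le_lipMajorant hL hhi x y
    rw [abs_of_nonpos (by linarith)] at h1 ⊢
    linarith
  · have h1 := hφ h.le
    have h2 := mul_nonneg hL (abs_nonneg (y - x'))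
    linarith

/-- A monotone step function whose total increase is less than `L (b - a) / 2` has a point in
`[a, b]` at which its growth in both directions is at most linear of slope `L`. Otherwise, at each
point the least Lipschitz majorant or the greatest Lipschitz minorant grows at speed `L`, while the
other one does not decrease, so that their sum increases by `L (b - a)` over `[a, b]`. -/
lemma exists_abs_sub_le_mul_abs_sub {a b : ℝ} (hab : a ≤ b) (hL : 0 < L) (hφ : Monotone φ)
    (hlo : ∀ x, lo ≤ φ x) (hhi : ∀ x, φ x ≤ hi) (hstep : ∀ x, ∃ x' > x, φ x' = φ x)
    (hinc : 2 * (hi - lo) < L * (b - a)) :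
    ∃ s ∈ Set.Icc a b, ∀ y, |φ y - φ s| ≤ L * |y - s| := by
  have hhi' : ∀ x, -φ x ≤ -lo := fun x => neg_le_neg (hlo x)
  set M := lipMajorant φ L with hM
  set m := lipMajorant (fun y => -φ y) L with hm
  have hMc : Continuous M := continuous_lipMajorant hL.le hhi
  have hmc : Continuous m := continuous_lipMajorant hL.le hhi'
  have hMm : Monotone M := lipMajorant_mono hL.le hhi hφ
  have hmm : Antitone m := by
    intro x x' hxx'
    refine ciSup_le fun y => ?_
    have h1 := le_lipMajorant hL.le hhi' x (y - (x' - x))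
    rw [show y - (x' - x) - x = y - x' by ring] at h1
    have := hφ (show y - (x' - x) ≤ y by linarith)
    linarith
  by_contra! hcon
  -- at a point where both envelopes touch `φ`, the growth of `φ` is bounded both ways
  have hbad : ∀ x ∈ Set.Icc a b, φ x < M x ∨ -φ x < m x := by
    intro x hx
    by_contra! h
    obtain ⟨y, hy⟩ := hcon x hx
    have h1 := le_lipMajorant hL.le hhi x y
    have h2 := le_lipMajorant hL.le hhi' x y
    rcases lt_abs.1 hy with h3 | h3 <;> linarith [h.1, h.2]
  have hall : Set.Icc a b ⊆ {x | M a - m a - L * a ≤ M x - m x - L * x} := by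
    refine IsClosed.Icc_subset_of_forall_exists_gt ?_ (Set.mem_ofPred.2 le_rfl) ?_
    · exact (isClosed_le continuous_const
        ((hMc.sub hmc).sub (continuous_const.mul continuous_id))).inter isClosed_Icc
    · rintro x ⟨hx, hxab⟩ z hz
      simp only [Set.mem_ofPred_eq] at hx
      rcases hbad x (Set.Ico_subset_Icc_self hxab) with h | h
      · obtain ⟨x₁, hx₁, hc⟩ := hstep x
        have hx' : x < min x₁ z := lt_min hx₁ hz
        have hc' : φ (min x₁ z) = φ x :=
          le_antisymm ((hφ (min_le_left _ _)).trans hc.le) (hφ hx'.le)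
        refine ⟨min x₁ z, ?_, hx', min_le_right _ _⟩
        have h1 := lipMajorant_add_le_of_lt hL.le hhi hφ hx'.le hc' h
        have h2 := hmm hx'.le
        simp only [Set.mem_ofPred_eq]
        linarith
      · have hx' : x < min (x + (φ x + m x) / L) z :=
          lt_min (by have := div_pos (show 0 < φ x + m x by linarith) hL; linarith) hz
        refine ⟨min (x + (φ x + m x) / L) z, ?_, hx', min_le_right _ _⟩
        have h1 := lipMajorant_neg_add_le_of_lt hL.le hlo hφ hx'.le (by
          have := min_le_left (x + (φ x + m x) / L) z
          rw [← le_div_iff₀' hL]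
          linarith)
        have h2 := hMm hx'.le
        simp only [Set.mem_ofPred_eq]
        linarith
  have hb : M a - m a - L * a ≤ M b - m b - L * b := hall ⟨hab, le_rfl⟩
  have h1 : M b ≤ hi := lipMajorant_le hL.le hhi b
  have h2 : -φ b ≤ m b := self_le_lipMajorant hL.le hhi' b
  have h3 : φ a ≤ M a := self_le_lipMajorant hL.le hhi a
  have h4 : m a ≤ -lo := lipMajorant_le hL.le hhi' a
  linarith [hlo a, hhi b]

end Growth

/-! ### Regular Bohr sets -/

section Regular
variable {G : Type*} [AddCommGroup G] [Fintype G]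

/-- Every scale `[r / 2, r]` contains a width at which the Bohr set is regular. -/
lemma exists_isRegularBohr (K : Finset (AddChar G ℂ)) {r : ℝ} (hr : 0 < r) :
    ∃ s, r / 2 ≤ s ∧ s ≤ r ∧ IsRegularBohr K s := by
  rcases K.eq_empty_or_nonempty with rfl | hK
  · refine ⟨r, by linarith, le_rfl, fun ε _ _ => ?_⟩
    simp [bohrSet]
  have hn : (1 : ℝ) ≤ K.card := by exact_mod_cast hK.card_pos
  set n : ℝ := (K.card : ℝ) with hn_def
  -- the logarithm of the size, as a function of the width clamped to `[r / 4, 2 r]`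
  let w : ℝ → ℝ := fun x => max (r / 4) (min x (2 * r))
  have hw0 : ∀ x, 0 < w x := fun x => lt_max_of_lt_left (by positivity)
  have hw_mono : Monotone w := fun x y h => max_le_max le_rfl (min_le_min h le_rfl)
  have hw_eq : ∀ x, r / 4 ≤ x → x ≤ 2 * r → w x = x := fun x h1 h2 => by
    simp only [w, min_eq_left h2, max_eq_right h1]
  have hcard0 : ∀ x, (0 : ℝ) < (bohrSet K (w x)).card := fun x => by
    exact_mod_cast card_bohrSet_pos K (hw0 x).le
  let φ : ℝ → ℝ := fun x => Real.log (bohrSet K (w x)).card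
  have hcard_mono : ∀ {u v : ℝ}, u ≤ v →
      ((bohrSet K u).card : ℝ) ≤ (bohrSet K v).card := fun h => by
    exact_mod_cast Finset.card_le_card (bohrSet_subset_bohrSet subset_rfl h)
  have hφ : Monotone φ := fun x y h => Real.log_le_log (hcard0 x) (hcard_mono (hw_mono h))
  have hB : (0 : ℝ) < (bohrSet K (r / 4)).card := by
    exact_mod_cast card_bohrSet_pos K (by positivity)
  have hlo : ∀ x, Real.log (bohrSet K (r / 4)).card ≤ φ x := fun x =>
    Real.log_le_log hB (hcard_mono (le_max_left _ _))
  have hhi : ∀ x, φ x ≤ Real.log (bohrSet K (2 * r)).card := fun x =>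
    Real.log_le_log (hcard0 x) (hcard_mono (max_le (by linarith) (min_le_right _ _)))
  have hstep : ∀ x, ∃ x' > x, φ x' = φ x := by
    intro x
    obtain ⟨v, hv, hvB⟩ := exists_gt_bohrSet_eq K (w x)
    refine ⟨x + (v - w x), by linarith, ?_⟩
    have h1 : w x ≤ w (x + (v - w x)) := hw_mono (by linarith)
    have h2 : w (x + (v - w x)) ≤ v := by
      have h3 : min x (2 * r) ≤ w x := le_max_right _ _
      have h4 : r / 4 ≤ w x := le_max_left _ _
      refine max_le (by linarith) ?_
      rcases le_total x (2 * r) with h | h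
      · rw [min_eq_left h] at h3
        exact (min_le_left _ _).trans (by linarith)
      · rw [min_eq_right h] at h3
        exact (min_le_right _ _).trans (by linarith)
    have h5 : bohrSet K (w (x + (v - w x))) = bohrSet K (w x) :=
      Finset.Subset.antisymm
        (hvB ▸ bohrSet_subset_bohrSet subset_rfl h2) (bohrSet_subset_bohrSet subset_rfl h1)
    simp only [φ, h5]
  have hinc : 2 * (Real.log (bohrSet K (2 * r)).card - Real.log (bohrSet K (r / 4)).card)
      < 50 * n / r * (r - r / 2) := by
    have h1 : ((bohrSet K (2 * r)).card : ℝ) ≤ ((2 * (16 : ℕ) + 1) ^ 2) ^ K.card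
        * (bohrSet K (r / 4)).card := by
      exact_mod_cast card_bohrSet_le_mul K (M := 16) (by positivity) (by push_cast; linarith)
    have h2 := Real.log_le_log (by exact_mod_cast card_bohrSet_pos K (by positivity)) h1
    rw [Real.log_mul (by positivity) hB.ne', Real.log_pow, ← hn_def] at h2
    have h3 : Real.log ((2 * ((16 : ℕ) : ℝ) + 1) ^ 2) ≤ 11 * Real.log 2 := by
      rw [← Real.log_rpow (by norm_num)]
      exact Real.log_le_log (by norm_num) (by norm_num)
    have h4 : n * Real.log ((2 * ((16 : ℕ) : ℝ) + 1) ^ 2) ≤ n * 8 := by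
      have := Real.log_two_lt_d9
      gcongr
      linarith
    have h5 : 50 * n / r * (r - r / 2) = 25 * n := by field_simp; norm_num
    have h6 := h2.trans (show _ ≤ n * 8 + Real.log (bohrSet K (r / 4)).card by gcongr)
    rw [h5]
    linarith
  obtain ⟨s, ⟨hs1, hs2⟩, hs⟩ := exists_abs_sub_le_mul_abs_sub (L := 50 * n / r)
    (show r / 2 ≤ r by linarith) (by positivity) hφ hlo hhi hstep hinc
  refine ⟨s, hs1, hs2, fun ε hε hε1 => ?_⟩
  have hs0 : 0 < s := by linarith
  have hε2 : ε ≤ 1 / 100 := by nlinarith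
  have hgrow : ∀ e : ℝ, |e| = ε →
      |Real.log (bohrSet K (s * (1 + e))).card - Real.log (bohrSet K s).card| ≤ 50 * n * ε := by
    intro e he
    have hle := abs_le.1 he.le
    have h := hs (s * (1 + e))
    simp only [φ] at h
    rw [hw_eq s (by linarith) (by linarith), hw_eq (s * (1 + e)) (by nlinarith) (by nlinarith),
      show s * (1 + e) - s = s * e by ring, abs_mul, he, abs_of_pos hs0] at h
    refine h.trans ?_
    calc 50 * n / r * (s * ε) = 50 * n * ε * (s / r) := by ring
      _ ≤ 50 * n * ε * 1 := by
          gcongr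
          rw [div_le_one hr]; exact hs2
      _ = 50 * n * ε := mul_one _
  have hpos : ∀ e : ℝ, |e| = ε → (0 : ℝ) < (bohrSet K (s * (1 + e))).card := fun e he => by
    have hle := abs_le.1 he.le
    exact_mod_cast card_bohrSet_pos K (mul_nonneg hs0.le (by linarith))
  have hposs : (0 : ℝ) < (bohrSet K s).card := by
    exact_mod_cast card_bohrSet_pos K hs0.le
  set u : ℝ := 50 * n * ε with hu
  have hu0 : 0 ≤ u := by positivity
  have hu1 : u ≤ 1 / 2 := by linarith
  have hu2 : 100 * n * ε = 2 * u := by rw [hu]; ring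
  rw [hu2]
  constructor
  · have h1 := (abs_le.1 (hgrow ε (abs_of_pos hε))).2
    have h2 : ((bohrSet K (s * (1 + ε))).card : ℝ) ≤ (bohrSet K s).card * Real.exp u := by
      rw [← Real.log_le_log_iff (hpos ε (abs_of_pos hε)) (by positivity),
        Real.log_mul hposs.ne' (Real.exp_pos _).ne', Real.log_exp]
      linarith
    have h3 : Real.exp u ≤ 1 + 2 * u := by
      have h4 := Real.abs_exp_sub_one_sub_id_le (show |u| ≤ 1 by rw [abs_of_nonneg hu0]; linarith)
      have := (abs_le.1 h4).2
      nlinarith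
    exact h2.trans (by gcongr)
  · have hε' : |(-ε)| = ε := by rw [abs_neg, abs_of_pos hε]
    have h1 := (abs_le.1 (hgrow (-ε) hε')).1
    have h2 : ((bohrSet K s).card : ℝ) * Real.exp (-u) ≤ (bohrSet K (s * (1 + -ε))).card := by
      rw [← Real.log_le_log_iff (by positivity) (hpos (-ε) hε'),
        Real.log_mul hposs.ne' (Real.exp_pos _).ne', Real.log_exp]
      linarith
    rw [sub_eq_add_neg 1 ε]
    refine le_trans ?_ h2
    gcongr
    linarith [Real.add_one_le_exp (-u)]

end Regular

/-! ### Autocorrelation -/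

section Autocorrelation
variable {G : Type*} [AddCommGroup G] [DecidableEq G]

/-- The number of pairs of elements of `A` with difference `y`, that is, `|A ∩ (A + y)|`. -/
def autocorr (A : Finset G) (y : G) : ℕ := (A.filter fun a => a + y ∈ A).card

lemma autocorr_zero (A : Finset G) : autocorr A 0 = A.card := by
  simp [autocorr]

lemma autocorr_neg (A : Finset G) (y : G) : autocorr A (-y) = autocorr A y := by
  refine Finset.card_nbij' (fun a => a + -y) (fun a => a + y) ?_ ?_ ?_ ?_ <;>
    simp +contextual [Set.MapsTo, Set.LeftInvOn]

lemma mem_translate {A : Finset G} {g z : G} : z ∈ translate A g ↔ z - g ∈ A := by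
  simp only [translate, Finset.mem_image]
  exact ⟨by rintro ⟨b, hb, rfl⟩; simpa using hb, fun h => ⟨_, h, by simp⟩⟩

lemma card_translate (A : Finset G) (g : G) : (translate A g).card = A.card :=
  Finset.card_image_of_injective _ (add_left_injective g)

lemma card_translate_sdiff_translate (A : Finset G) (g h : G) :
    ((translate A g \ translate A h).card : ℝ) = A.card - autocorr A (g - h) := by
  have h1 : translate A g ∩ translate A h
      = (A.filter fun a => a + (g - h) ∈ A).image (fun a => a + g) := by
    ext z
    simp only [Finset.mem_inter, mem_translate, Finset.mem_image, Finset.mem_filter]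
    constructor
    · rintro ⟨h1, h2⟩
      exact ⟨z - g, ⟨h1, by simpa using h2⟩, by simp⟩
    · rintro ⟨a, ⟨h1, h2⟩, rfl⟩
      exact ⟨by simpa using h1, by rwa [add_sub_assoc]⟩
  have h2 : (translate A g ∩ translate A h).card = autocorr A (g - h) := by
    rw [h1, Finset.card_image_of_injective _ (add_left_injective g), autocorr]
  have h3 := Finset.card_sdiff_add_card_inter (translate A g) (translate A h)
  rw [h2, card_translate] at h3
  rw [← h3]
  push_cast
  ring

lemma card_inter_translate (A B : Finset G) (x : G) :
    (A ∩ translate B x).card = (B.filter fun y => x + y ∈ A).card := by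
  have : A ∩ translate B x = (B.filter fun y => x + y ∈ A).image (fun y => y + x) := by
    ext z
    simp only [Finset.mem_inter, mem_translate, Finset.mem_image, Finset.mem_filter]
    constructor
    · rintro ⟨h1, h2⟩
      exact ⟨z - x, ⟨h2, by simpa using h1⟩, by simp⟩
    · rintro ⟨y, ⟨h1, h2⟩, rfl⟩
      exact ⟨by rwa [add_comm], by simpa using h1⟩
  rw [this, Finset.card_image_of_injective _ (add_left_injective x)]

/-- If every shift by an element of `B` moves few elements of `A` out of `A`, then `A` fills most of
a translate of `B`: the pairs `(a, y) ∈ A × B` with `a + y ∈ A` are counted in two ways. -/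
lemma exists_le_card_inter_translate_of_autocorr (A B : Finset G) (hA : A.Nonempty) {θ : ℝ}
    (h : ∀ y ∈ B, θ * A.card ≤ autocorr A y) :
    ∃ x : G, θ * B.card ≤ ((A ∩ translate B x).card : ℝ) := by
  have hsum : ∑ y ∈ B, autocorr A y = ∑ x ∈ A, (A ∩ translate B x).card := by
    simp only [autocorr, card_inter_translate, Finset.card_filter]
    exact Finset.sum_comm
  have h1 : ∑ x ∈ A, θ * (B.card : ℝ) ≤ ∑ x ∈ A, ((A ∩ translate B x).card : ℝ) := by
    have h2 := Finset.sum_le_sum h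
    rw [Finset.sum_const, nsmul_eq_mul] at h2
    rw [Finset.sum_const, nsmul_eq_mul, ← Nat.cast_sum, ← hsum, Nat.cast_sum]
    linarith
  obtain ⟨x, -, hx⟩ := Finset.exists_le_of_sum_le hA h1
  exact ⟨x, hx⟩

variable [Fintype G]

/-- A set has its average density on some translate of any given set. -/
lemma exists_le_card_inter_translate (A B : Finset G) {θ : ℝ}
    (h : θ * Fintype.card G ≤ A.card) :
    ∃ x : G, θ * B.card ≤ ((A ∩ translate B x).card : ℝ) := by
  have hsum : ∑ x : G, (A ∩ translate B x).card = B.card * A.card := by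
    simp only [card_inter_translate, Finset.card_filter]
    rw [Finset.sum_comm, ← smul_eq_mul, ← Finset.sum_const]
    refine Finset.sum_congr rfl fun y _ => ?_
    refine (Fintype.sum_equiv (Equiv.addRight y) (fun x => if x + y ∈ A then 1 else 0)
      (fun x => if x ∈ A then 1 else 0) (fun _ => rfl)).trans ?_
    simp
  have h1 : ∑ x : G, θ * (B.card : ℝ) ≤ ∑ x : G, ((A ∩ translate B x).card : ℝ) := by
    rw [Finset.sum_const, nsmul_eq_mul, ← Nat.cast_sum, hsum, Finset.card_univ]
    push_cast
    nlinarith [Nat.cast_nonneg (α := ℝ) B.card]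
  obtain ⟨x, -, hx⟩ := Finset.exists_le_of_sum_le ⟨0, Finset.mem_univ _⟩ h1
  exact ⟨x, hx⟩

/-- The autocorrelation has nonnegative Fourier coefficients. -/
lemma card_mul_autocorr (A : Finset G) (y : G) :
    (Fintype.card G : ℝ) * autocorr A y
      = ∑ γ : AddChar G ℂ, ‖∑ a ∈ A, γ a‖ ^ 2 * (γ y).re := by
  have hterm : ∀ γ : AddChar G ℂ, ((‖∑ a ∈ A, γ a‖ ^ 2 : ℝ) : ℂ) * γ y
      = ∑ a ∈ A, ∑ b ∈ A, γ (a - b + y) := by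
    intro γ
    rw [Complex.ofReal_pow, ← Complex.mul_conj', map_sum, Finset.sum_mul_sum, Finset.sum_mul]
    refine Finset.sum_congr rfl fun a _ => ?_
    rw [Finset.sum_mul]
    refine Finset.sum_congr rfl fun b _ => ?_
    rw [AddChar.map_add_eq_mul, sub_eq_add_neg, AddChar.map_add_eq_mul, AddChar.map_neg_eq_conj]
  have hcomplex : (((Fintype.card G : ℝ) * autocorr A y : ℝ) : ℂ)
      = ∑ γ : AddChar G ℂ, ((‖∑ a ∈ A, γ a‖ ^ 2 : ℝ) : ℂ) * γ y := by
    simp_rw [hterm]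
    rw [Finset.sum_comm]
    simp_rw [Finset.sum_comm (s := Finset.univ) (t := A), AddChar.sum_apply_eq_ite]
    have : ∀ a ∈ A, (∑ b ∈ A, if a - b + y = 0 then (Fintype.card G : ℂ) else 0)
        = if a + y ∈ A then (Fintype.card G : ℂ) else 0 := by
      intro a _
      have hab : ∀ b, a - b + y = 0 ↔ a + y = b := fun b => by
        rw [sub_add_eq_add_sub, sub_eq_zero]
      simp_rw [hab, Finset.sum_ite_eq]
    rw [Finset.sum_congr rfl this, ← Finset.sum_filter, Finset.sum_const, nsmul_eq_mul, autocorr]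
    push_cast
    ring
  have hre := congrArg Complex.re hcomplex
  simpa only [Complex.ofReal_re, Complex.re_sum, Complex.re_ofReal_mul] using hre

lemma card_mul_card_sub_autocorr (A : Finset G) (y : G) :
    (Fintype.card G : ℝ) * (A.card - autocorr A y)
      = ∑ γ : AddChar G ℂ, ‖∑ a ∈ A, γ a‖ ^ 2 * (1 - (γ y).re) := by
  have h0 := card_mul_autocorr A 0
  simp only [AddChar.map_zero_eq_one, Complex.one_re, mul_one, autocorr_zero] at h0
  simp_rw [mul_sub, mul_one, Finset.sum_sub_distrib, ← card_mul_autocorr, ← h0]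

/-- If shifts by elements of `T` hardly move `A`, then neither do shifts by points at which the
characters of the large spectrum of `T` are close to `1`. As `A` has nonnegative Fourier weights, it
suffices to compare coefficients: a character `γ` outside the large spectrum has
`1 - Re γ(y) ≤ 2`, which is at most four times the average of `1 - Re γ(t)` over `T`. -/
lemma card_sub_autocorr_le (A T : Finset G) (hT : T.Nonempty) {ε κ : ℝ} (hκ : 0 ≤ κ)
    (hTA : ∀ t ∈ T, (A.card : ℝ) - autocorr A t ≤ ε * A.card) {y : G}
    (hy : ∀ γ ∈ largeSpectrum T, ‖γ y - 1‖ ≤ κ) :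
    (A.card : ℝ) - autocorr A y ≤ (κ + 4 * ε) * A.card := by
  have hT0 : (0 : ℝ) < T.card := by exact_mod_cast hT.card_pos
  have hG0 : (0 : ℝ) < Fintype.card G := by exact_mod_cast Fintype.card_pos_iff.2 ⟨0⟩
  have hre : ∀ (γ : AddChar G ℂ) (z : G), |(γ z).re| ≤ 1 := fun γ z =>
    (Complex.abs_re_le_norm _).trans (AddChar.norm_apply γ z).le
  have hpt : ∀ γ : AddChar G ℂ,
      1 - (γ y).re ≤ κ + 4 / T.card * ∑ t ∈ T, (1 - (γ t).re) := by
    intro γ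
    have hnn : 0 ≤ ∑ t ∈ T, (1 - (γ t).re) :=
      Finset.sum_nonneg fun t _ => by linarith [(abs_le.1 (hre γ t)).2]
    by_cases hγ : γ ∈ largeSpectrum T
    · have h1 := hy γ hγ
      have h2 := (abs_le.1 (Complex.abs_re_le_norm (γ y - 1))).1
      rw [Complex.sub_re, Complex.one_re] at h2
      have : 0 ≤ 4 / T.card * ∑ t ∈ T, (1 - (γ t).re) := by positivity
      linarith
    · have h1 : ∑ t ∈ T, (γ t).re < T.card / 2 := by
        simpa [largeSpectrum] using hγ
      have h2 : (T.card : ℝ) / 2 ≤ ∑ t ∈ T, (1 - (γ t).re) := by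
        rw [Finset.sum_sub_distrib, Finset.sum_const, nsmul_eq_mul, mul_one]
        linarith
      have h3 : 4 / (T.card : ℝ) * (T.card / 2) ≤ 4 / T.card * ∑ t ∈ T, (1 - (γ t).re) := by
        gcongr
      rw [show 4 / (T.card : ℝ) * (T.card / 2) = 2 by field_simp; norm_num] at h3
      linarith [(abs_le.1 (hre γ y)).1]
  have hmain : (Fintype.card G : ℝ) * (A.card - autocorr A y)
      ≤ κ * (Fintype.card G * A.card)
        + 4 / T.card * ∑ t ∈ T, (Fintype.card G : ℝ) * (A.card - autocorr A t) := by
    have h0 := card_mul_autocorr A 0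
    simp only [AddChar.map_zero_eq_one, Complex.one_re, mul_one, autocorr_zero] at h0
    simp_rw [card_mul_card_sub_autocorr, h0]
    rw [Finset.sum_comm, Finset.mul_sum, Finset.mul_sum, ← Finset.sum_add_distrib]
    refine Finset.sum_le_sum fun γ _ => ?_
    rw [← Finset.mul_sum]
    have := mul_le_mul_of_nonneg_left (hpt γ) (sq_nonneg ‖∑ a ∈ A, γ a‖)
    linarith
  have hsum : ∑ t ∈ T, (Fintype.card G : ℝ) * (A.card - autocorr A t)
      ≤ T.card * (Fintype.card G * (ε * A.card)) := by
    rw [← nsmul_eq_mul]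
    exact Finset.sum_le_card_nsmul _ _ _ fun t ht =>
      mul_le_mul_of_nonneg_left (hTA t ht) hG0.le
  have h4 : 4 / (T.card : ℝ) * ∑ t ∈ T, (Fintype.card G : ℝ) * (A.card - autocorr A t)
      ≤ 4 / T.card * (T.card * (Fintype.card G * (ε * A.card))) := by gcongr
  rw [show 4 / (T.card : ℝ) * (T.card * (Fintype.card G * (ε * A.card)))
    = Fintype.card G * (4 * ε * A.card) by field_simp] at h4
  refine le_of_mul_le_mul_left ?_ hG0
  linarith

/-- Small VC-dimension yields many shifts that hardly move `A`: the translates of `A` by a maximal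
set of pairwise distant shifts form a separated family, to which the packing lemma applies, and the
maximal set of shifts covers `G` up to almost-invariant shifts. -/
lemma exists_almost_invariant_shifts (A : Finset G) (hA : A.Nonempty) {d : ℕ}
    (hd : vcDimension A ≤ d) {ε : ℝ} (hε0 : 0 < ε) (hε1 : ε ≤ 1) :
    ∃ T : Finset G, T.Nonempty ∧ (∀ t ∈ T, (A.card : ℝ) - autocorr A t ≤ ε * A.card) ∧
      Real.log (Fintype.card G / T.card)
        ≤ 3 * d * Real.log (4 * Fintype.card G / (ε * A.card)) := by
  have hA0 : (0 : ℝ) < A.card := by exact_mod_cast hA.card_pos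
  have hG0 : (0 : ℝ) < Fintype.card G := by exact_mod_cast Fintype.card_pos_iff.2 ⟨0⟩
  have hAG : (A.card : ℝ) ≤ Fintype.card G := by exact_mod_cast Finset.card_le_univ A
  set T : Finset G :=
    Finset.univ.filter fun t => (A.card : ℝ) - autocorr A t ≤ ε * A.card with hTdef
  have hT0 : (0 : G) ∈ T := by
    simp only [hTdef, Finset.mem_filter, Finset.mem_univ, true_and, autocorr_zero, sub_self]
    positivity
  have hTneg : ∀ t, -t ∈ T → t ∈ T := fun t ht => by
    simpa [hTdef, autocorr_neg] using ht
  have hTpos : (0 : ℝ) < T.card := by exact_mod_cast Finset.card_pos.2 ⟨0, hT0⟩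
  obtain ⟨S, hS⟩ := (Finset.univ.filter fun S : Finset G =>
    ∀ g ∈ S, ∀ h ∈ S, g ≠ h → g - h ∉ T).exists_maximal ⟨∅, by simp⟩
  have hsep : ∀ g ∈ S, ∀ h ∈ S, g ≠ h → g - h ∉ T := (Finset.mem_filter.1 hS.1).2
  have hcover : ∀ x : G, ∃ g ∈ S, x - g ∈ T := by
    intro x
    by_contra! hx
    have hxS : x ∉ S := fun h => hx x h (by rwa [sub_self])
    refine hxS (hS.2 (Finset.mem_filter.2 ⟨Finset.mem_univ _, ?_⟩)
      (Finset.subset_insert x S) (Finset.mem_insert_self x S))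
    intro g hg h hh hgh
    rcases Finset.mem_insert.1 hg with rfl | hgS
    · rcases Finset.mem_insert.1 hh with rfl | hh
      · exact absurd rfl hgh
      · exact hx h hh
    · rcases Finset.mem_insert.1 hh with rfl | hh
      · exact fun hmem => hx g hgS (hTneg _ (by rwa [neg_sub]))
      · exact hsep g hgS h hh hgh
  have hGST : (Fintype.card G : ℝ) ≤ S.card * T.card := by
    have : (Finset.univ : Finset G) ⊆ Finset.image₂ (· + ·) S T := fun x _ => by
      obtain ⟨g, hg, hx⟩ := hcover x
      exact Finset.mem_image₂.2 ⟨g, hg, x - g, hx, by simp⟩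
    exact_mod_cast (Finset.card_le_card this).trans (Finset.card_image₂_le _ _ _)
  have hdiff : ∀ g ∈ S, ∀ h ∈ S, g ≠ h →
      ε * A.card < ((translate A g \ translate A h).card : ℝ) := by
    intro g hg h hh hgh
    have := hsep g hg h hh hgh
    rw [card_translate_sdiff_translate]
    have hlt : ¬ (A.card : ℝ) - autocorr A (g - h) ≤ ε * A.card := fun hle =>
      this (Finset.mem_filter.2 ⟨Finset.mem_univ _, hle⟩)
    exact not_le.1 hlt
  have hinj : Set.InjOn (translate A) (S : Set G) := by
    intro g hg h hh hgh
    by_contra hne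
    have := hdiff g hg h hh hne
    rw [hgh, Finset.sdiff_self, Finset.card_empty, Nat.cast_zero] at this
    exact absurd this (not_lt.2 (by positivity))
  set δ : ℝ := ε * A.card / Fintype.card G with hδ
  have hpack := log_card_le_of_separated (S.image (translate A)) (δ := δ) (d := d)
    (by positivity) (by rw [hδ, div_le_one hG0]; nlinarith)
    ((Finset.vcDim_mono (Finset.image_subset_image (Finset.subset_univ S))).trans hd) (by
      intro P hP R hR hPR
      obtain ⟨g, hg, rfl⟩ := Finset.mem_image.1 hP
      obtain ⟨h, hh, rfl⟩ := Finset.mem_image.1 hR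
      rw [hδ, div_mul_cancel₀ _ hG0.ne']
      refine (hdiff g hg h hh fun hgh => hPR (by rw [hgh])).le.trans ?_
      exact_mod_cast Finset.card_le_card (Finset.subset_union_left))
  rw [Finset.card_image_of_injOn hinj, hδ, div_div_eq_mul_div] at hpack
  refine ⟨T, ⟨0, hT0⟩, fun t ht => (Finset.mem_filter.1 ht).2, le_trans ?_ hpack⟩
  refine Real.log_le_log (by positivity) ?_
  rwa [div_le_iff₀ hTpos]

end Autocorrelation

/-! ### Density on Bohr sets -/

section Density
variable {G : Type*} [AddCommGroup G] [Fintype G] [DecidableEq G]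

/-- The rank of the new frequencies: `log (32 / (η α))` is absorbed into `log² (2/η) L / η²` once
`L ≥ log (1/α)` and `L ≥ η`. -/
lemma rank_bound_aux {η L D : ℝ} (hη0 : 0 < η) (hη1 : η ≤ 1) (hD : 0 ≤ D) (hL : η ≤ L) :
    24 * D * (5 * Real.log (2 / η) + L)
      ≤ 400 * (1 / η ^ 2 * D * Real.log (2 / η) ^ 2 * L) := by
  have hl : 1 / 2 ≤ Real.log (2 / η) := by
    have h1 : Real.log 2 ≤ Real.log (2 / η) :=
      Real.log_le_log (by norm_num) (by rw [le_div_iff₀ hη0]; linarith)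
    linarith [Real.log_two_gt_d9]
  set l := Real.log (2 / η)
  have hL0 : 0 < L := by linarith
  have h1 : 1 ≤ 1 / η ^ 2 * L := by
    rw [one_div, inv_mul_eq_div, le_div_iff₀ (by positivity)]; nlinarith
  have h2 : 1 ≤ 1 / η ^ 2 := by
    rw [le_div_iff₀ (by positivity)]; nlinarith
  have h3 : l ≤ 2 * l ^ 2 := by nlinarith
  have h4 : 1 ≤ 4 * l ^ 2 := by nlinarith
  have h5 : l ≤ 2 * l ^ 2 * (1 / η ^ 2 * L) := by nlinarith [sq_nonneg l]
  have h6 : L ≤ 4 * l ^ 2 * (1 / η ^ 2 * L) := by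
    have h7 : 1 ≤ 4 * l ^ 2 * (1 / η ^ 2) := by nlinarith
    nlinarith
  have h7 : 5 * l + L ≤ 14 * (l ^ 2 * (1 / η ^ 2 * L)) := by linarith
  have h8 : 0 ≤ l ^ 2 * (1 / η ^ 2 * L) := by positivity
  calc 24 * D * (5 * l + L) ≤ 24 * D * (14 * (l ^ 2 * (1 / η ^ 2 * L))) := by gcongr
    _ ≤ _ := by nlinarith [mul_nonneg hD h8]

/-- The case where `A` misses a proportion greater than `η` of the group. -/
lemma exists_bohrSet_of_vcDimension_of_lt (A : Finset G) (hA : A.Nonempty)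
    (K : Finset (AddChar G ℂ)) {d : ℕ} (hd : vcDimension A ≤ d) {η ρ α : ℝ} (hη0 : 0 < η)
    (hη1 : η ≤ 1) (hρ0 : 0 < ρ) (hρ1 : ρ ≤ 1) (hα0 : 0 < α) (hα : α * Fintype.card G ≤ A.card)
    (hlt : (A.card : ℝ) < (1 - η) * Fintype.card G) :
    ∃ (x : G) (K' : Finset (AddChar G ℂ)) (ρ' : ℝ) (t' : ℕ),
      K ⊆ K' ∧ ρ' ≤ ρ ∧ K'.card ≤ K.card + t' ∧ ρ * η / (4 * max (t' : ℝ) 1) ≤ ρ' ∧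
      IsRegularBohr K' ρ' ∧
      (t' : ℝ) ≤ 400 * (1 / η ^ 2 * d * Real.log (2 / η) ^ 2 * Real.log (1 / α)) ∧
      (1 - η) * (bohrSet K' ρ').card ≤ ((A ∩ translate (bohrSet K' ρ') x).card : ℝ) := by
  classical
  have hA0 : (0 : ℝ) < A.card := by exact_mod_cast hA.card_pos
  have hG0 : (0 : ℝ) < Fintype.card G := by exact_mod_cast Fintype.card_pos_iff.2 ⟨0⟩
  obtain ⟨T, hT, hTA, hTlog⟩ := exists_almost_invariant_shifts A hA hd
    (ε := η / 8) (by positivity) (by linarith)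
  obtain ⟨Λ, hΛcard, hΛ⟩ := exists_largeSpectrum_subset_addSpan T hT
  set t : ℝ := max (Λ.card : ℝ) 1 with ht
  have ht1 : 1 ≤ t := le_max_right _ _
  have hΛt : (Λ.card : ℝ) ≤ t := le_max_left _ _
  -- at this width, characters in the span of `Λ` are within `η / 2` of `1`
  have hr0 : 0 < min ρ (η / (2 * t)) := lt_min hρ0 (by positivity)
  obtain ⟨s, hs1, hs2, hreg⟩ := exists_isRegularBohr (K ∪ Λ) hr0
  have hauto : ∀ y ∈ bohrSet (K ∪ Λ) s, (1 - η) * A.card ≤ autocorr A y := by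
    intro y hy
    have h := card_sub_autocorr_le A T hT (ε := η / 8) (κ := η / 2) (by positivity) hTA (y := y)
      (fun γ hγ => by
        refine (norm_sub_one_le_of_mem_addSpan (hΛ hγ) (r := η / (2 * t)) fun χ hχ =>
          (mem_bohrSet.1 hy χ (Finset.mem_union_right _ hχ)).trans
            (hs2.trans (min_le_right _ _))).trans ?_
        calc (Λ.card : ℝ) * (η / (2 * t)) ≤ t * (η / (2 * t)) := by gcongr
          _ = η / 2 := by field_simp)
    linarith
  obtain ⟨x, hx⟩ := exists_le_card_inter_translate_of_autocorr A _ hA hauto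
  refine ⟨x, K ∪ Λ, s, Λ.card, Finset.subset_union_left, hs2.trans (min_le_left _ _),
    Finset.card_union_le _ _, ?_, hreg, ?_, hx⟩
  · refine le_trans ?_ hs1
    rw [← ht, le_div_iff₀ two_pos, le_min_iff]
    constructor
    · rw [div_mul_eq_mul_div, div_le_iff₀ (by positivity)]
      nlinarith [mul_le_mul_of_nonneg_left hη1 hρ0.le, mul_le_mul_of_nonneg_left ht1 hρ0.le]
    · rw [div_mul_eq_mul_div, div_le_div_iff₀ (by positivity) (by positivity)]
      have := mul_le_mul_of_nonneg_right hρ1 (show 0 ≤ η * t by positivity)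
      nlinarith
  · have hα1 : α < 1 - η := lt_of_mul_lt_mul_right (hα.trans_lt hlt) hG0.le
    have hL : η ≤ Real.log (1 / α) := by
      have := Real.log_le_sub_one_of_pos hα0
      rw [one_div, Real.log_inv]
      linarith
    refine (hΛcard.trans ?_).trans (rank_bound_aux hη0 hη1 (Nat.cast_nonneg d) hL)
    have h1 : Real.log (4 * Fintype.card G / (η / 8 * A.card))
        ≤ 5 * Real.log (2 / η) + Real.log (1 / α) := by
      have h2 : 4 * (Fintype.card G : ℝ) / (η / 8 * A.card) ≤ (2 / η) ^ 5 * (1 / α) := by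
        have h3 : (Fintype.card G : ℝ) / A.card ≤ 1 / α := by
          rw [div_le_div_iff₀ hA0 hα0]; linarith
        have h4 : 32 / η ≤ (2 / η) ^ 5 := by
          rw [div_pow, div_le_div_iff₀ hη0 (by positivity)]
          have : η ^ 5 ≤ η := pow_le_of_le_one hη0.le hη1 (by norm_num)
          linarith
        calc 4 * (Fintype.card G : ℝ) / (η / 8 * A.card)
            = 32 / η * (Fintype.card G / A.card) := by field_simp; norm_num
          _ ≤ _ := by gcongr
      have h3 := Real.log_le_log (by positivity) h2
      rwa [Real.log_mul (by positivity) (by positivity), Real.log_pow] at h3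
    have h2 : 3 * (d : ℝ) * Real.log (4 * Fintype.card G / (η / 8 * A.card))
        ≤ 3 * d * (5 * Real.log (2 / η) + Real.log (1 / α)) := by gcongr
    linarith

/-- A set of bounded VC-dimension and density at least `α` in the group fills most of a translate
of a Bohr set that refines a prescribed one. -/
lemma exists_bohrSet_of_vcDimension (A : Finset G) (hA : A.Nonempty)
    (K : Finset (AddChar G ℂ)) {d : ℕ} (hd : vcDimension A ≤ d) {η ρ α : ℝ} (hη0 : 0 < η)
    (hη1 : η ≤ 1) (hρ0 : 0 < ρ) (hρ1 : ρ ≤ 1) (hα0 : 0 < α) (hα : α * Fintype.card G ≤ A.card) :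
    ∃ (x : G) (K' : Finset (AddChar G ℂ)) (ρ' : ℝ) (t' : ℕ),
      K ⊆ K' ∧ ρ' ≤ ρ ∧ K'.card ≤ K.card + t' ∧ ρ * η / (4 * max (t' : ℝ) 1) ≤ ρ' ∧
      IsRegularBohr K' ρ' ∧
      (t' : ℝ) ≤ 400 * (1 / η ^ 2 * d * Real.log (2 / η) ^ 2 * Real.log (1 / α)) ∧
      (1 - η) * (bohrSet K' ρ').card ≤ ((A ∩ translate (bohrSet K' ρ') x).card : ℝ) := by
  rcases lt_or_ge (A.card : ℝ) ((1 - η) * Fintype.card G) with hlt | hge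
  · exact exists_bohrSet_of_vcDimension_of_lt A hA K hd hη0 hη1 hρ0 hρ1 hα0 hα hlt
  · obtain ⟨s, hs1, hs2, hreg⟩ := exists_isRegularBohr K hρ0
    obtain ⟨x, hx⟩ := exists_le_card_inter_translate A (bohrSet K s) hge
    have hG0 : (0 : ℝ) < Fintype.card G := by exact_mod_cast Fintype.card_pos_iff.2 ⟨0⟩
    have hα1 : α ≤ 1 := by
      refine le_of_mul_le_mul_right (hα.trans ?_) hG0
      rw [one_mul]
      exact_mod_cast Finset.card_le_univ A
    have hL : 0 ≤ Real.log (1 / α) := Real.log_nonneg (by rw [le_div_iff₀ hα0]; linarith)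
    refine ⟨x, K, s, 0, subset_rfl, hs2, by simp, le_trans ?_ hs1, hreg, ?_, hx⟩
    · have := mul_le_mul_of_nonneg_left hη1 hρ0.le
      norm_num
      linarith
    · rw [Nat.cast_zero]
      positivity

/-- Sets of bounded VC-dimension are dense on Bohr sets. -/
theorem dense_on_bohrSet_of_vcDimension {η β ρ σ : ℝ} {d : ℕ} {A : Finset G}
    {K : Finset (AddChar G ℂ)} (hη0 : 0 < η) (hη1 : η ≤ 1) (hβ0 : 0 < β) (hρ0 : 0 < ρ)
    (hρ1 : ρ ≤ 1) (hσ0 : 0 < σ) (hσ1 : σ ≤ 1) (hd : vcDimension A ≤ d)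
    (hβ : ((bohrSet K ρ).card : ℝ) = β * Fintype.card G)
    (hσ : σ * (bohrSet K ρ).card ≤ ((A ∩ bohrSet K ρ).card : ℝ)) :
    ∃ (x : G) (K' : Finset (AddChar G ℂ)) (ρ' : ℝ) (t' : ℕ),
      0 < ρ' ∧ ρ' ≤ 1 ∧ IsRegularBohr K' ρ' ∧ bohrSet K' ρ' ⊆ bohrSet K ρ ∧
      K'.card ≤ K.card + t' ∧
      1 / 4 * (ρ * η / (max (K.card : ℝ) 1 ^ 2 * max (t' : ℝ) 1)) ≤ ρ' ∧
      (t' : ℝ) ≤ 400 * (Real.log (1 / σ)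
        + 1 / η ^ 2 * d * Real.log (2 / η) ^ 2 * Real.log (1 / (σ * β))) ∧
      (1 - η) * (bohrSet K' ρ').card ≤ ((A ∩ translate (bohrSet K' ρ') x).card : ℝ) := by
  have hG0 : (0 : ℝ) < Fintype.card G := by exact_mod_cast Fintype.card_pos_iff.2 ⟨0⟩
  have hAc : σ * β * Fintype.card G ≤ A.card := by
    rw [mul_assoc, ← hβ]
    refine hσ.trans ?_
    exact_mod_cast Finset.card_le_card Finset.inter_subset_left
  have hA : A.Nonempty := Finset.card_pos.1 (by
    have : (0 : ℝ) < A.card := lt_of_lt_of_le (by positivity) hAc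
    exact_mod_cast this)
  obtain ⟨x, K', ρ', t', hK, hρ', hcard, hlow, hreg, ht', hx⟩ :=
    exists_bohrSet_of_vcDimension A hA K hd hη0 hη1 hρ0 hρ1 (mul_pos hσ0 hβ0) hAc
  have hlow0 : 0 < ρ * η / (4 * max (t' : ℝ) 1) := by positivity
  refine ⟨x, K', ρ', t', hlow0.trans_le hlow, hρ'.trans hρ1, hreg,
    bohrSet_subset_bohrSet hK hρ', hcard, le_trans ?_ hlow, ht'.trans ?_, hx⟩
  · rw [← div_div, show ρ * η / (4 * max (t' : ℝ) 1) = 1 / 4 * (ρ * η / max (t' : ℝ) 1) by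
      field_simp]
    gcongr
    refine div_le_self (by positivity) ?_
    nlinarith [le_max_right (K.card : ℝ) 1]
  · have : 0 ≤ Real.log (1 / σ) := Real.log_nonneg (by rw [le_div_iff₀ hσ0]; linarith)
    linarith

/-! ### Stable sets -/

/-- A shattered set of size `k` yields an instance of the `k`-order property, by taking the traces
to be the initial segments of an enumeration. -/
lemma IsStable.vcDimension_le {k : ℕ} {A : Finset G} (hA : IsStable k A) : vcDimension A ≤ k := by
  by_contra! hlt
  refine hA ?_
  obtain ⟨W, hW, hWk⟩ : ∃ W ∈ (Finset.univ.image (fun g : G => translate A g)).shatterer,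
      k < W.card := by
    by_contra! h
    exact absurd (Finset.sup_le h) (not_le.2 hlt)
  rw [Finset.mem_shatterer] at hW
  let e : Fin k → G := fun i => (W.equivFin.symm (Fin.castLE hWk.le i) : G)
  have he : Function.Injective e := fun i j hij => by
    simpa using W.equivFin.symm.injective (Subtype.ext hij)
  have heW : ∀ i, e i ∈ W := fun i => (W.equivFin.symm _).2
  have htrace : ∀ j : Fin k, ∃ g : G, ∀ i, e i - g ∈ A ↔ i ≤ j := by
    intro j
    obtain ⟨u, hu, huW⟩ := hW (t := (Finset.univ.filter (· ≤ j)).image e) (by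
      intro z hz
      obtain ⟨i, -, rfl⟩ := Finset.mem_image.1 hz
      exact heW i)
    obtain ⟨g, -, rfl⟩ := Finset.mem_image.1 hu
    refine ⟨g, fun i => ?_⟩
    have h := Finset.ext_iff.1 huW (e i)
    rw [Finset.mem_inter, mem_translate] at h
    simpa [heW i, he.eq_iff] using h
  choose g hg using htrace
  exact ⟨e, fun j => -g j, fun i j => by rw [← sub_eq_add_neg]; exact hg j i⟩

/-- For small `ε`, the cube of `log (2/ε)`, and hence also its square, is at most `54/ε`. -/
lemma log_two_div_pow_le {ε : ℝ} (hε0 : 0 < ε) (hε1 : ε < 1 / 6) :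
    1 ≤ Real.log (2 / ε) ∧ Real.log (2 / ε) ^ 3 ≤ 54 / ε := by
  have h12 : 12 ≤ 2 / ε := by rw [le_div_iff₀ hε0]; linarith
  have h1 : 1 ≤ Real.log (2 / ε) := by
    rw [Real.le_log_iff_exp_le (by positivity)]
    linarith [Real.exp_one_lt_three]
  refine ⟨h1, ?_⟩
  have h2 : Real.log (2 / ε) / 3 ≤ Real.exp (Real.log (2 / ε) / 3) := by
    linarith [Real.add_one_le_exp (Real.log (2 / ε) / 3)]
  have h3 := pow_le_pow_left₀ (by positivity) h2 3
  rw [← Real.exp_nat_mul, show ((3 : ℕ) : ℝ) * (Real.log (2 / ε) / 3) = Real.log (2 / ε) by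
    push_cast; ring, Real.exp_log (by positivity)] at h3
  rw [show 54 / ε = 27 * (2 / ε) by ring]
  linarith

lemma le_mul_mul_one_div_pow {ε P k : ℝ} (hε0 : 0 < ε) (hε1 : ε ≤ 1) (hP : 0 ≤ P) (hk : 1 ≤ k) :
    P ≤ P * k * (1 / ε ^ 3) := by
  have hε3 : 1 ≤ 1 / ε ^ 3 := by
    rw [le_div_iff₀ (by positivity), one_mul]
    exact pow_le_one₀ hε0.le hε1
  rw [mul_assoc]
  exact le_mul_of_one_le_right hP (one_le_mul_of_one_le_of_one_le hk hε3)

/-- The rank bound for VC-dimension `k`, threshold `ε` and inverse density `exp L` is of the order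
`k / ε³`. -/
lemma stable_rank_bound_aux {ε P k L : ℝ} (hε0 : 0 < ε) (hε1 : ε < 1 / 6) (hP : 0 ≤ P)
    (hk : 1 ≤ k) (hL : L ≤ Real.log (1 / ε) + 6 * P) :
    1 / ε ^ 2 * k * Real.log (2 / ε) ^ 2 * L ≤ 324 * ((P + 1) * k * (1 / ε ^ 3)) := by
  obtain ⟨hl1, hl3⟩ := log_two_div_pow_le hε0 hε1
  have hql : Real.log (1 / ε) ≤ Real.log (2 / ε) :=
    Real.log_le_log (by positivity) (by gcongr; norm_num)
  generalize Real.log (2 / ε) = l at *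
  have hmain : l ^ 2 * L ≤ 324 * (1 / ε) * (P + 1) := by
    calc l ^ 2 * L ≤ l ^ 2 * (l * (6 * (P + 1))) := by
          gcongr
          nlinarith
      _ = l ^ 3 * (6 * (P + 1)) := by ring
      _ ≤ 54 / ε * (6 * (P + 1)) := by gcongr
      _ = 324 * (1 / ε) * (P + 1) := by ring
  calc 1 / ε ^ 2 * k * l ^ 2 * L = 1 / ε ^ 2 * k * (l ^ 2 * L) := by ring
    _ ≤ 1 / ε ^ 2 * k * (324 * (1 / ε) * (P + 1)) := by gcongr
    _ = 324 * ((P + 1) * k * (1 / ε ^ 3)) := by field_simp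

/-- Stable sets are dense on Bohr sets. -/
theorem dense_on_bohrSet_of_isStable {ε ρ : ℝ} {k : ℕ} {A : Finset G}
    {K : Finset (AddChar G ℂ)} (hε0 : 0 < ε) (hε1 : ε < 1 / 6) (hρ0 : 0 < ρ) (hρ1 : ρ ≤ 1)
    (hA : IsStable k A) (hAB : ε * (bohrSet K ρ).card ≤ ((A ∩ bohrSet K ρ).card : ℝ))
    {M : ℝ} (hM : M = 200000 * ((K.card * (1 + Real.log (1 / ρ)) + 1) * k * (1 / ε ^ 3)
      + Real.log (1 / ε))) :
    ∃ (x : G) (K' : Finset (AddChar G ℂ)) (ρ' : ℝ),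
      0 < ρ' ∧ ρ' ≤ 1 ∧ IsRegularBohr K' ρ' ∧ bohrSet K' ρ' ⊆ bohrSet K ρ ∧
      (K'.card : ℝ) ≤ M ∧ 1 / 4 * ρ * ε / M ^ 3 ≤ ρ' ∧
      (1 - ε) * (bohrSet K' ρ').card ≤ ((A ∩ translate (bohrSet K' ρ') x).card : ℝ) := by
  have hG0 : (0 : ℝ) < Fintype.card G := by exact_mod_cast Fintype.card_pos_iff.2 ⟨0⟩
  have hB0 : (0 : ℝ) < (bohrSet K ρ).card := by exact_mod_cast card_bohrSet_pos K hρ0.le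
  have hk : (1 : ℝ) ≤ k := by
    rcases Nat.eq_zero_or_pos k with rfl | h
    · exact absurd ⟨Fin.elim0, Fin.elim0, fun i => i.elim0⟩ hA
    · exact_mod_cast h
  set β : ℝ := (bohrSet K ρ).card / Fintype.card G with hβ
  have hβ0 : 0 < β := by positivity
  obtain ⟨x, K', ρ', t', h1, h2, h3, h4, h5, h6, h7, h8⟩ :=
    dense_on_bohrSet_of_vcDimension (η := ε) (β := β) (σ := ε) hε0 (by linarith) hβ0 hρ0 hρ1 hε0
      (by linarith) hA.vcDimension_le (by rw [hβ, div_mul_cancel₀ _ hG0.ne']) hAB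
  have hlρ : 0 ≤ Real.log (1 / ρ) := Real.log_nonneg (by rw [le_div_iff₀ hρ0]; linarith)
  have hq0 : 0 ≤ Real.log (1 / ε) := Real.log_nonneg (by rw [le_div_iff₀ hε0]; linarith)
  have hlog : Real.log (1 / (ε * β))
      ≤ Real.log (1 / ε) + 6 * (K.card * (1 + Real.log (1 / ρ))) := by
    rw [one_div, mul_inv, Real.log_mul (by positivity) (by positivity), ← one_div, hβ, inv_div]
    gcongr
    exact log_card_div_card_bohrSet_le K hρ0 hρ1
  have hKP : (K.card : ℝ) ≤ K.card * (1 + Real.log (1 / ρ)) :=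
    le_mul_of_one_le_right (Nat.cast_nonneg _) (by linarith)
  have hP0 := (Nat.cast_nonneg K.card).trans hKP
  have hle := stable_rank_bound_aux hε0 hε1 hP0 hk hlog
  have hQ1 := le_mul_mul_one_div_pow hε0 (by linarith) (by linarith : 0 ≤
    (K.card : ℝ) * (1 + Real.log (1 / ρ)) + 1) hk
  generalize (K.card : ℝ) * (1 + Real.log (1 / ρ)) = P at *
  generalize (P + 1) * k * (1 / ε ^ 3) = Q at *
  generalize Real.log (1 / ε) = q at *
  have ht : (t' : ℝ) ≤ 400 * (q + 324 * Q) := by linarith only [h7, hle]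
  have hK'M : (K'.card : ℝ) ≤ M := by
    have : (K'.card : ℝ) ≤ K.card + t' := by exact_mod_cast h5
    linarith only [this, ht, hM, hKP, hQ1, hq0, hP0]
  have hM1 : 1 ≤ M := by linarith only [hM, hQ1, hq0, hP0]
  have hKM : max (K.card : ℝ) 1 ≤ M :=
    max_le (by linarith only [hM, hKP, hQ1, hq0, hP0]) hM1
  have htM : max (t' : ℝ) 1 ≤ M :=
    max_le (by linarith only [ht, hM, hQ1, hq0, hP0]) hM1
  refine ⟨x, K', ρ', h1, h2, h3, h4, hK'M, le_trans ?_ h6, h8⟩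
  rw [mul_assoc, mul_div_assoc, pow_succ M 2]
  gcongr

end Density

end StableBohr

theorem mainTheorem5 :
    (∃ C c : ℝ, 0 < C ∧ 0 < c ∧
      ∀ (G : Type*) [AddCommGroup G] [Fintype G] [DecidableEq G]
        (η β ρ σ : ℝ) (d : ℕ) (A : Finset G) (K : Finset (AddChar G ℂ)),
        0 < η → η ≤ 1 → 0 < β → β ≤ 1 → 0 < ρ → ρ ≤ 1 → 0 < σ → σ ≤ 1 →
        StableBohr.vcDimension A ≤ d →
        ((StableBohr.bohrSet K ρ).card : ℝ) = β * (Fintype.card G : ℝ) →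
        σ * ((StableBohr.bohrSet K ρ).card : ℝ)
          ≤ ((A ∩ StableBohr.bohrSet K ρ).card : ℝ) →
        ∃ (x : G) (K' : Finset (AddChar G ℂ)) (ρ' : ℝ) (t' : ℕ),
          0 < ρ' ∧ ρ' ≤ 1 ∧
          StableBohr.IsRegularBohr K' ρ' ∧
          StableBohr.bohrSet K' ρ' ⊆ StableBohr.bohrSet K ρ ∧
          K'.card ≤ K.card + t' ∧
          c * (ρ * η / ((max (K.card : ℝ) 1) ^ 2 * max (t' : ℝ) 1)) ≤ ρ' ∧
          (t' : ℝ) ≤ C * (Real.log (1 / σ)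
            + (1 / η ^ 2) * (d : ℝ) * (Real.log (2 / η)) ^ 2 * Real.log (1 / (σ * β))) ∧
          (1 - η) * ((StableBohr.bohrSet K' ρ').card : ℝ)
            ≤ ((A ∩ StableBohr.translate (StableBohr.bohrSet K' ρ') x).card : ℝ))
    ∧
    (∃ C₁ C₂ : ℝ, 1 ≤ C₁ ∧ 0 < C₂ ∧
      ∀ (G : Type*) [AddCommGroup G] [Fintype G] [DecidableEq G]
        (ε ρ : ℝ) (k : ℕ) (A : Finset G) (K : Finset (AddChar G ℂ)),
        0 < ε → ε < 1 / 6 → 0 < ρ → ρ ≤ 1 →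
        StableBohr.IsStable k A →
        ε * ((StableBohr.bohrSet K ρ).card : ℝ)
          ≤ ((A ∩ StableBohr.bohrSet K ρ).card : ℝ) →
        ∃ (x : G) (K' : Finset (AddChar G ℂ)) (ρ' : ℝ),
          0 < ρ' ∧ ρ' ≤ 1 ∧
          StableBohr.IsRegularBohr K' ρ' ∧
          StableBohr.bohrSet K' ρ' ⊆ StableBohr.bohrSet K ρ ∧
          (K'.card : ℝ) ≤ C₁ * (((K.card : ℝ) * (1 + Real.log (1 / ρ)) + 1) * (k : ℝ) * (1 / ε ^ 3)
            + Real.log (1 / ε)) ∧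
          C₂ * ρ * ε /
            (C₁ * (((K.card : ℝ) * (1 + Real.log (1 / ρ)) + 1) * (k : ℝ) * (1 / ε ^ 3)
              + Real.log (1 / ε))) ^ 3 ≤ ρ' ∧
          (1 - ε) * ((StableBohr.bohrSet K' ρ').card : ℝ)
            ≤ ((A ∩ StableBohr.translate (StableBohr.bohrSet K' ρ') x).card : ℝ)) := by
  refine ⟨⟨400, 1 / 4, by norm_num, by norm_num, ?_⟩, ⟨200000, 1 / 4, by norm_num, by norm_num, ?_⟩⟩
  · intro G _ _ _ η β ρ σ d A K hη0 hη1 hβ0 _ hρ0 hρ1 hσ0 hσ1 hd hβ hσ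
    exact StableBohr.dense_on_bohrSet_of_vcDimension hη0 hη1 hβ0 hρ0 hρ1 hσ0 hσ1 hd hβ hσ
  · intro G _ _ _ ε ρ k A K hε0 hε1 hρ0 hρ1 hA hAB
    exact StableBohr.dense_on_bohrSet_of_isStable hε0 hε1 hρ0 hρ1 hA hAB rfl
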